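/- Let $\alpha>0$, $\lambda<0$, $\omega>0$, $\kappa,\nu\in\mathbb{R}$ and $R\in\mathbb{C}$, put $\eta(\xi)=R\,e^{-\mathrm{i}\kappa\xi}$, and consider for $\phi=\phi(\tau,\xi)\in\mathbb{C}$, $\tau\ge 0$, $\xi\in\mathbb{R}$, the equation $$\mathrm{i}\phi_\tau=-\phi_{\xi\xi}-\frac{\mathrm{i}\alpha}{2}\phi-\Big(\frac{3\lambda}{2\omega}|R|^2-\nu\Big)\phi+N(\phi),\qquad N(\phi)=-\frac{3\lambda}{2\omega}\big[|\phi+\eta|^2-|\eta|^2\big](\phi+\eta),\tag{1}$$ together with the energy $$E[\varphi]=\int_{\mathbb{R}}\Big\{|\varphi_\xi|^2-\Big(\frac{3\lambda}{2\omega}|R|^2-\nu\Big)|\varphi|^2-\frac{3\lambda}{4\omega}\big[|\varphi+\eta|^2-|\eta|^2\big]^2\Big\}\,d\xi .$$ For every integer $k\ge 1$ there is $\delta_0>0$ such that for every $\varphi_0\in H^k(\mathbb{R})$ with $E[\varphi_0]<\delta_0$ there is a unique $\phi\in C([0,\infty),H^k(\mathbb{R}))$ with $\phi(0)=\varphi_0$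 that solves (1) in the sense of distributions: for every Schwartz function $\psi$, the function $\tau\mapsto\int_{\mathbb{R}}\phi(\tau,\xi)\psi(\xi)\,d\xi$ is differentiable on $[0,\infty)$ (one-sidedly at $0$) and $$\mathrm{i}\frac{d}{d\tau}\int_{\mathbb{R}}\phi\,\psi\,d\xi=\int_{\mathbb{R}}\Big\{-\phi\,\psi''-\frac{\mathrm{i}\alpha}{2}\phi\,\psi-\Big(\frac{3\lambda}{2\omega}|R|^2-\nu\Big)\phi\,\psi+N(\phi)\,\psi\Big\}\,d\xi\qquad\text{for all }\tau\ge 0 .$$ -/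

import Mathlib

open MeasureTheory Set

open scoped SchwartzMap

noncomputable section

namespace LugiatoLefever

/-- The Hilbert space `L²(ℝ)` of complex-valued functions, with Lebesgue measure. -/
abbrev L2 : Type := Lp ℂ 2 (volume : Measure ℝ)

/-- `IsWeakDeriv i f g`: the `i`-th distributional derivative of `f ∈ L²(ℝ)` is `g ∈ L²(ℝ)`. -/
def IsWeakDeriv (i : ℕ) (f g : L2) : Prop :=
  (TemperedDistribution.derivCLM ℂ)^[i] (Lp.toTemperedDistribution f)
    = Lp.toTemperedDistribution g

/-- The Sobolev space `H^k(ℝ)`. An element is stored as the tuple `(f, f', …, f⁽ᵏ⁾)` of an `L²`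
function and its distributional derivatives up to order `k`, all of which lie in `L²(ℝ)`; the
tuple is determined by `f`. The norm inherited from the `ℓ²`-product of `k + 1` copies of `L²(ℝ)`
is `(∑ i ≤ k, ‖f⁽ⁱ⁾‖²_{L²}) ^ (1/2)`. -/
def H (k : ℕ) : Submodule ℂ (PiLp 2 (fun _ : Fin (k + 1) => L2)) where
  carrier := {F | ∀ i : Fin (k + 1), IsWeakDeriv i (F 0) (F i)}
  add_mem' := by
    intro F G hF hG i
    have h1 := hF i
    have h2 := hG i
    simp only [IsWeakDeriv, ← Lp.toTemperedDistributionCLM_apply] at h1 h2 ⊢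
    rw [PiLp.add_apply, PiLp.add_apply, map_add, map_add, ← h1, ← h2, iterate_map_add]
  zero_mem' := by
    intro i
    simp only [IsWeakDeriv, ← Lp.toTemperedDistributionCLM_apply]
    rw [PiLp.zero_apply, PiLp.zero_apply, map_zero, iterate_map_zero]
  smul_mem' := by
    intro c F hF i
    have h1 := hF i
    simp only [IsWeakDeriv, ← Lp.toTemperedDistributionCLM_apply] at h1 ⊢
    rw [PiLp.smul_apply, PiLp.smul_apply, map_smul, map_smul, ← h1]
    exact Function.Commute.iterate_left
      (fun x => (TemperedDistribution.derivCLM ℂ).map_smul c x) i _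

/-- The function underlying an element of `H^k(ℝ)`. -/
def H.fn {k : ℕ} (u : H k) : ℝ → ℂ := (u : PiLp 2 (fun _ : Fin (k + 1) => L2)) 0

/-- The weak first derivative of an element of `H^k(ℝ)`, `k ≥ 1`. -/
def H.fn' {k : ℕ} (hk : 1 ≤ k) (u : H k) : ℝ → ℂ :=
  (u : PiLp 2 (fun _ : Fin (k + 1) => L2)) ⟨1, Nat.lt_succ_of_le hk⟩

/-- The real constants `α, λ, ω, κ, ν` (`lam` is `λ`) and the complex constant `R`. -/
structure Params where
  α : ℝ
  lam : ℝ
  ω : ℝ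
  κ : ℝ
  ν : ℝ
  R : ℂ

namespace Params

variable (P : Params)

/-- The plane wave background `η(ξ) = R exp(-iκξ)`. -/
def η (ξ : ℝ) : ℂ := P.R * Complex.exp (-(Complex.I * P.κ * ξ))

/-- The real coefficient `(3λ/2ω)|R|² - ν`. -/
def c : ℝ := 3 * P.lam / (2 * P.ω) * ‖P.R‖ ^ 2 - P.ν

/-- The nonlinearity `N(u) = -(3λ/2ω) (|u + η|² - |η|²) (u + η)`. -/
def N (u : ℝ → ℂ) (ξ : ℝ) : ℂ :=
  ((-(3 * P.lam / (2 * P.ω)) * (‖u ξ + P.η ξ‖ ^ 2 - ‖P.η ξ‖ ^ 2) : ℝ) : ℂ) * (u ξ + P.η ξ)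

/-- The energy
`E[u] = ∫ |u_ξ|² - ((3λ/2ω)|R|² - ν) |u|² - (3λ/4ω) (|u + η|² - |η|²)² dξ`. -/
def E {k : ℕ} (hk : 1 ≤ k) (u : H k) : ℝ :=
  ∫ ξ : ℝ, (‖H.fn' hk u ξ‖ ^ 2 - P.c * ‖H.fn u ξ‖ ^ 2
    - 3 * P.lam / (4 * P.ω) * (‖H.fn u ξ + P.η ξ‖ ^ 2 - ‖P.η ξ‖ ^ 2) ^ 2)

/-- `φ : [0,∞) → H^k(ℝ)` solves
`i φ_τ = -φ_ξξ - (iα/2) φ - ((3λ/2ω)|R|² - ν) φ + N(φ)` in the sense of distributions in `ξ`,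
at every time `τ ≥ 0` (with the one-sided time derivative at `τ = 0`). Only the values of `φ` on
`[0,∞)` matter. -/
def IsSolution {k : ℕ} (φ : ℝ → H k) : Prop :=
  ∀ ψ : 𝓢(ℝ, ℂ), ∀ τ : ℝ, 0 ≤ τ →
    HasDerivWithinAt (fun s : ℝ => Complex.I * ∫ ξ : ℝ, H.fn (φ s) ξ * ψ ξ)
      (∫ ξ : ℝ, (-(H.fn (φ τ) ξ * iteratedDeriv 2 ψ ξ)
        - Complex.I * P.α / 2 * H.fn (φ τ) ξ * ψ ξ
        - P.c * H.fn (φ τ) ξ * ψ ξ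
        + P.N (H.fn (φ τ)) ξ * ψ ξ))
      (Ici 0) τ

/-- `φ ∈ C([0,∞), H^k(ℝ))` is a global solution with initial value `φ₀`. -/
structure IsGlobalSolution {k : ℕ} (φ₀ : H k) (φ : ℝ → H k) : Prop where
  continuousOn : ContinuousOn φ (Ici 0)
  initial : φ 0 = φ₀
  solves : P.IsSolution φ

end Params

end LugiatoLefever

end

open MeasureTheory Set
open scoped SchwartzMap
noncomputable section
namespace LugiatoLefever
open scoped FourierTransform LineDeriv ENNReal Topology
open Filter
variable {k : ℕ}

/-! Write `g = -3λ/(2ω)`, which is nonnegative, and `ρ = |φ + η|² - |η|²`. The equation reads `φ_τ =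
iφ_ξξ + force(φ)`, where `force` involves no derivatives. In one dimension `H^k` with `k ≥ 1` is an
algebra on which multiplication by `η` and `η̄` is bounded, so `force` is Lipschitz on bounded sets.
In the interaction picture `v(τ) = exp(-iτ∂²)φ(τ)` the equation becomes an ordinary differential
equation in `H^k` with a locally Lipschitz field, and it has a global solution as soon as the norm
is bounded a priori on every finite interval (`exists_global_solution`).

The bound in `H^1` comes from the defocusing sign `g ≥ 0`. The modified energy `‖φ‖²_{H^1} +
(g/2)‖ρ‖²_{L²}` is coercive. In its time derivative the terms containing `∂N(φ)` cancel, and what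
remains is bounded by a constant times the energy itself (`modEnergyRate_eq`,
`exists_modEnergyRate_le`). Grönwall gives at most exponential growth for data of every size. Higher
norms follow by induction on `k`, since a tame estimate makes `force` linearly bounded in the top
norm once the norm one order below is controlled (`exists_bound`).

Solutions are only continuous into `H^1`, so `φ_τ` exists only in a negative-order space. The chain
rule `IsWeakSolution.hasDerivWithinAt_of_sub_eq` nevertheless differentiates functionals whose
increments pair `φ(s) - φ(t)` with an `H^1` gradient. It justifies the derivative of `‖ρ‖²` and of
the squared `L²` distance of two solutions. The latter, with an `L²` Lipschitz bound for `force`,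
gives uniqueness among distributional solutions. -/

/-! ### Weak derivatives in `L²` and their Fourier description. -/

/-- The function `g ∈ L²` is the weak derivative of `f ∈ L²`. -/
def HasWeakDeriv (f g : L2) : Prop :=
  TemperedDistribution.derivCLM ℂ (Lp.toTemperedDistribution f) = Lp.toTemperedDistribution g

theorem toTemperedDistribution_injective :
    Function.Injective (fun f : L2 => Lp.toTemperedDistribution f) := by
  have h := Lp.ker_toTemperedDistributionCLM_eq_bot (F := ℂ) (μ := (volume : Measure ℝ)) (p := 2)
  exact LinearMap.ker_eq_bot.1 h

theorem hasWeakDeriv_iff {f g : L2} :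
    HasWeakDeriv f g ↔ ∀ ψ : 𝓢(ℝ, ℂ), ∫ x, deriv ψ x * f x = -∫ x, ψ x * g x := by
  unfold HasWeakDeriv
  constructor
  · intro h ψ
    have := congrArg (fun T => T ψ) h
    simp only [TemperedDistribution.derivCLM_apply_apply, Lp.toTemperedDistribution_apply] at this
    simp only [smul_eq_mul] at this
    rw [← this, ← integral_neg]
    simp
  · intro h
    ext ψ
    have := h ψ
    simp only [TemperedDistribution.derivCLM_apply_apply, Lp.toTemperedDistribution_apply]
    simp only [smul_eq_mul]
    rw [← neg_neg (∫ x, ψ x * g x), ← h, ← integral_neg]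
    simp

theorem HasWeakDeriv.unique {f g g' : L2} (h : HasWeakDeriv f g) (h' : HasWeakDeriv f g') :
    g = g' :=
  toTemperedDistribution_injective (h.symm.trans h')

/-- Closedness of differentiation lets the product rule pass from Schwartz functions to `H^1` by
density. -/
theorem isClosed_hasWeakDeriv : IsClosed {p : L2 × L2 | HasWeakDeriv p.1 p.2} := by
  have h : {p : L2 × L2 | HasWeakDeriv p.1 p.2} =
      {p : L2 × L2 | TemperedDistribution.derivCLM ℂ
        (Lp.toTemperedDistributionCLM ℂ volume 2 p.1) =
          Lp.toTemperedDistributionCLM ℂ volume 2 p.2} := rfl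
  rw [h]
  exact isClosed_eq (by fun_prop) (by fun_prop)

/-- The `L²` class of a Schwartz function. -/
abbrev schwartzL2 (ψ : 𝓢(ℝ, ℂ)) : L2 := ψ.toLp 2

theorem hasWeakDeriv_schwartz (ψ : 𝓢(ℝ, ℂ)) :
    HasWeakDeriv (schwartzL2 ψ) (schwartzL2 (SchwartzMap.derivCLM ℂ ℂ ψ)) := by
  unfold HasWeakDeriv
  rw [Lp.toTemperedDistribution_toLp_eq, Lp.toTemperedDistribution_toLp_eq,
    TemperedDistribution.derivCLM_toTemperedDistributionCLM_eq ℂ]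

theorem integral_schwartz_mul_eq_inner (ψ : 𝓢(ℝ, ℂ)) (f : L2) :
    inner ℂ (schwartzL2 ψ) f = ∫ x, f x * (starRingEnd ℂ) (ψ x) := by
  rw [L2.inner_def]
  refine integral_congr_ae ?_
  filter_upwards [ψ.coeFn_toLp 2 volume] with x hx
  rw [hx]
  simp

theorem ae_eq_of_forall_integral_schwartz {f g : ℝ → ℂ} (hf : LocallyIntegrable f)
    (hg : LocallyIntegrable g) (h : ∀ ψ : 𝓢(ℝ, ℂ), ∫ x, ψ x * f x = ∫ x, ψ x * g x) :
    f =ᵐ[volume] g := by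
  refine ae_eq_of_integral_contDiff_smul_eq hf hg ?_
  intro χ hχ hc
  have hc' : HasCompactSupport (fun x => (χ x : ℂ)) := hc.comp_left (g := Complex.ofReal) rfl
  have := h (hc'.toSchwartzMap (Complex.ofRealCLM.contDiff.comp hχ))
  simpa [HasCompactSupport.toSchwartzMap] using! this

theorem locallyIntegrable_L2 (f : L2) : LocallyIntegrable (fun x => f x) :=
  (Lp.memLp f).locallyIntegrable one_le_two

theorem hasWeakDeriv_iff_lineDeriv {f g : L2} :
    HasWeakDeriv f g ↔
      ∂_{(1 : ℝ)} (Lp.toTemperedDistribution f) = Lp.toTemperedDistribution g := by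
  unfold HasWeakDeriv
  have : TemperedDistribution.derivCLM ℂ (Lp.toTemperedDistribution f) =
      ∂_{(1 : ℝ)} (Lp.toTemperedDistribution f) := by
    ext ψ
    rw [TemperedDistribution.derivCLM_apply_apply, TemperedDistribution.lineDerivOp_apply_apply]
    congr 2
  rw [this]

/-- The Fourier transform turns differentiation into multiplication by a symbol, so Fourier
multipliers such as the free group visibly commute with it. -/
theorem hasWeakDeriv_iff_fourier {f g : L2} :
    HasWeakDeriv f g ↔ ((𝓕 g : L2) : ℝ → ℂ) =ᵐ[volume] fun ξ => 2 * Real.pi * Complex.I * ξ * (𝓕 f : L2) ξ := by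
  have hξ : (fun x : ℝ => ((inner ℝ x (1:ℝ) : ℝ) : ℂ)).HasTemperateGrowth := by fun_prop
  have h1 : HasWeakDeriv f g ↔ 𝓕 (∂_{(1 : ℝ)} (Lp.toTemperedDistribution f)) =
      𝓕 (Lp.toTemperedDistribution g) := by
    rw [hasWeakDeriv_iff_lineDeriv]
    constructor
    · intro h; rw [h]
    · intro h
      have := congrArg (fun T => 𝓕⁻ T) h
      simpa using this
  rw [h1, TemperedDistribution.fourier_lineDerivOp_eq, Lp.fourier_toTemperedDistribution_eq,
    Lp.fourier_toTemperedDistribution_eq]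
  have hL : ∀ ψ : 𝓢(ℝ, ℂ), ((2 * Real.pi * Complex.I) • TemperedDistribution.smulLeftCLM ℂ
      (fun x : ℝ => ((inner ℝ x (1:ℝ) : ℝ) : ℂ)) (Lp.toTemperedDistribution (𝓕 f))) ψ =
      ∫ x, ψ x * (2 * Real.pi * Complex.I * x * (𝓕 f : L2) x) := by
    intro ψ
    simp only [smul_apply,
      TemperedDistribution.smulLeftCLM_apply_apply, Lp.toTemperedDistribution_apply]
    rw [← integral_smul]
    congr 1
    ext x
    rw [SchwartzMap.smulLeftCLM_apply_apply hξ]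
    simp
    ring
  have hR : ∀ ψ : 𝓢(ℝ, ℂ), (Lp.toTemperedDistribution (𝓕 g : L2)) ψ =
      ∫ x, ψ x * (𝓕 g : L2) x := by
    intro ψ
    simp only [Lp.toTemperedDistribution_apply, smul_eq_mul]
  constructor
  · intro h
    refine ae_eq_of_forall_integral_schwartz (locallyIntegrable_L2 _) ?_ ?_
    · have : LocallyIntegrable (fun ξ : ℝ => (2 * Real.pi * Complex.I * ξ) • (𝓕 f : L2) ξ) :=
        LocallyIntegrable.continuous_smul (by fun_prop) (locallyIntegrable_L2 _)
      exact this
    · intro ψ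
      rw [← hR, ← hL, ← h]
  · intro h
    ext ψ
    rw [hL, hR]
    refine integral_congr_ae ?_
    filter_upwards [h] with x hx
    rw [hx]

/-! ### Multiplication by bounded functions and dominated convergence in `L²`. -/

/-- Pointwise multiplication of an `L²` function by a bounded function. -/
def mulL2 : Lp ℂ ∞ (volume : Measure ℝ) →L[ℂ] L2 →L[ℂ] L2 :=
  (ContinuousLinearMap.mul ℂ ℂ).holderL volume ∞ 2 2

theorem coeFn_mulL2 (a : Lp ℂ ∞ (volume : Measure ℝ)) (f : L2) :
    mulL2 a f =ᵐ[volume] fun x => a x * f x :=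
  ContinuousLinearMap.coeFn_holder (r := 2) (ContinuousLinearMap.mul ℂ ℂ) a f

theorem norm_mulL2_le (a : Lp ℂ ∞ (volume : Measure ℝ)) (f : L2) :
    ‖mulL2 a f‖ ≤ ‖a‖ * ‖f‖ := by
  have := ContinuousLinearMap.norm_holder_apply_apply_le (r := 2)
    (ContinuousLinearMap.mul ℂ ℂ) a f
  simpa using! this

theorem norm_sq_L2 (f : L2) : ‖f‖ ^ 2 = ∫ x, ‖f x‖ ^ 2 := by
  have h := @inner_self_eq_norm_sq ℂ L2 _ _ _ f
  rw [← h, L2.inner_def, ← integral_re]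
  · congr 1
    ext x
    exact inner_self_eq_norm_sq (f x)
  · exact L2.integrable_inner f f

theorem norm_L2_le_of_ae {f : L2} {g : L2} (h : ∀ᵐ x, ‖f x‖ ≤ ‖g x‖) : ‖f‖ ≤ ‖g‖ :=
  Lp.norm_le_norm_of_ae_le h

theorem integrable_norm_sq_L2 (f : L2) : Integrable fun x => ‖f x‖ ^ 2 :=
  (Lp.memLp f).integrable_norm_pow two_ne_zero

theorem tendsto_L2_of_dominated {ι : Type*} {l : Filter ι} [l.IsCountablyGenerated]
    {F : ι → L2} {a : ι → ℝ → ℂ} {f b : L2} (hF : ∀ i, F i =ᵐ[volume] a i)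
    (hb : ∀ i, ∀ᵐ x, ‖a i x‖ ≤ ‖b x‖)
    (hlim : ∀ᵐ x, Tendsto (fun i => a i x) l (𝓝 (f x))) : Tendsto F l (𝓝 f) := by
  rw [tendsto_iff_norm_sub_tendsto_zero]
  have h2 : Tendsto (fun i => ‖F i - f‖ ^ 2) l (𝓝 0) := by
    have key : Tendsto (fun i => ∫ x, ‖a i x - f x‖ ^ 2) l (𝓝 (∫ _x : ℝ, (0 : ℝ))) := by
      refine tendsto_integral_filter_of_dominated_convergence
        (fun x => 2 * ‖b x‖ ^ 2 + 2 * ‖f x‖ ^ 2) ?_ ?_ ?_ ?_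
      · refine Eventually.of_forall fun i => ?_
        exact ((((Lp.aestronglyMeasurable (F i)).congr (hF i)).sub (Lp.aestronglyMeasurable _)).norm.pow 2)
      · refine Eventually.of_forall fun i => ?_
        filter_upwards [hb i] with x hx
        rw [Real.norm_of_nonneg (by positivity)]
        have h1 : ‖a i x - f x‖ ≤ ‖b x‖ + ‖f x‖ := (norm_sub_le _ _).trans (by gcongr)
        have h0 := norm_nonneg (a i x - f x)
        nlinarith [sq_nonneg (‖b x‖ - ‖f x‖)]
      · exact ((integrable_norm_sq_L2 b).const_mul 2).add ((integrable_norm_sq_L2 f).const_mul 2)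
      · filter_upwards [hlim] with x hx
        have := ((hx.sub_const (f x)).norm).pow 2
        simpa using this
    rw [integral_zero] at key
    refine key.congr fun i => ?_
    rw [norm_sq_L2]
    refine integral_congr_ae ?_
    filter_upwards [Lp.coeFn_sub (F i) f, hF i] with x hx hx'
    rw [hx, Pi.sub_apply, hx']
  have := h2.sqrt
  simpa [Real.sqrt_sq (norm_nonneg _)] using this

/-! ### The free Schrödinger group on `L²`. -/

/-- The Fourier symbol `exp(-it(2πξ)²)` of the free Schrödinger group. -/
def phase (t ξ : ℝ) : ℂ := Complex.exp (((-(t * (2 * Real.pi * ξ) ^ 2) : ℝ) : ℂ) * Complex.I)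

theorem norm_phase (t ξ : ℝ) : ‖phase t ξ‖ = 1 := Complex.norm_exp_ofReal_mul_I _

theorem continuous_phase (t : ℝ) : Continuous (phase t) := by
  unfold phase; fun_prop

theorem memLp_phase (t : ℝ) : MemLp (phase t) ∞ (volume : Measure ℝ) :=
  memLp_top_of_bound (continuous_phase t).aestronglyMeasurable 1
    (Eventually.of_forall fun ξ => (norm_phase t ξ).le)

/-- The free Schrödinger group `exp(it∂²)` on `L²`. -/
def freeL2 (t : ℝ) : L2 →L[ℂ] L2 :=
  ((Lp.fourierTransformₗᵢ ℝ ℂ).symm : L2 →L[ℂ] L2) ∘L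
    (mulL2 ((memLp_phase t).toLp _)) ∘L ((Lp.fourierTransformₗᵢ ℝ ℂ) : L2 →L[ℂ] L2)

theorem fourier_freeL2 (t : ℝ) (f : L2) :
    ((𝓕 (freeL2 t f) : L2) : ℝ → ℂ) =ᵐ[volume] fun ξ => phase t ξ * (𝓕 f : L2) ξ := by
  have h : (𝓕 (freeL2 t f) : L2) = mulL2 ((memLp_phase t).toLp _) (𝓕 f : L2) :=
    (Lp.fourierTransformₗᵢ ℝ ℂ).apply_symm_apply _
  rw [h]
  filter_upwards [coeFn_mulL2 ((memLp_phase t).toLp _) (𝓕 f : L2),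
    (memLp_phase t).coeFn_toLp] with ξ h1 h2
  rw [h1, h2]

theorem L2_ext_fourier {f g : L2} (h : ((𝓕 f : L2) : ℝ → ℂ) =ᵐ[volume] (𝓕 g : L2)) : f = g :=
  (Lp.fourierTransformₗᵢ ℝ ℂ).injective (Lp.ext h)

theorem freeL2_zero (f : L2) : freeL2 0 f = f := by
  apply L2_ext_fourier
  filter_upwards [fourier_freeL2 0 f] with ξ h
  simp [h, phase]

theorem freeL2_freeL2 (s t : ℝ) (f : L2) : freeL2 s (freeL2 t f) = freeL2 (s + t) f := by
  apply L2_ext_fourier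
  filter_upwards [fourier_freeL2 s (freeL2 t f), fourier_freeL2 t f,
    fourier_freeL2 (s + t) f] with ξ h1 h2 h3
  rw [h1, h2, h3, ← mul_assoc, phase, phase, phase, ← Complex.exp_add]
  congr 2
  push_cast
  ring

theorem norm_freeL2 (t : ℝ) (f : L2) : ‖freeL2 t f‖ = ‖f‖ := by
  rw [← Lp.norm_fourier_eq, ← Lp.norm_fourier_eq f]
  apply le_antisymm
  · refine norm_L2_le_of_ae ?_
    filter_upwards [fourier_freeL2 t f] with ξ h
    rw [h, norm_mul, norm_phase, one_mul]
  · refine norm_L2_le_of_ae ?_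
    filter_upwards [fourier_freeL2 t f] with ξ h
    rw [h, norm_mul, norm_phase, one_mul]

theorem inner_freeL2_right (t : ℝ) (f g : L2) :
    inner ℂ f (freeL2 t g) = inner ℂ (freeL2 (-t) f) g := by
  have h : f = freeL2 t (freeL2 (-t) f) := by rw [freeL2_freeL2, add_neg_cancel, freeL2_zero]
  conv_lhs => rw [h]
  exact LinearIsometry.inner_map_map ⟨(freeL2 t : L2 →ₗ[ℂ] L2), norm_freeL2 t⟩ _ _

theorem HasWeakDeriv.freeL2 {f g : L2} (h : HasWeakDeriv f g) (t : ℝ) :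
    HasWeakDeriv (freeL2 t f) (freeL2 t g) := by
  rw [hasWeakDeriv_iff_fourier] at h ⊢
  filter_upwards [h, fourier_freeL2 t f, fourier_freeL2 t g] with ξ h1 h2 h3
  rw [h2, h3, h1]
  ring

theorem tendsto_of_tendsto_fourier {ι : Type*} {l : Filter ι} {F : ι → L2} {f : L2}
    (h : Tendsto (fun i => (𝓕 (F i) : L2)) l (𝓝 (𝓕 f))) : Tendsto F l (𝓝 f) :=
  ((Lp.fourierTransformₗᵢ ℝ ℂ).isometry.isEmbedding.tendsto_nhds_iff).2 h

theorem continuous_freeL2 (f : L2) : Continuous fun t => freeL2 t f := by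
  rw [continuous_iff_continuousAt]
  intro t
  apply tendsto_of_tendsto_fourier
  refine tendsto_L2_of_dominated (b := 𝓕 f) (fun s => fourier_freeL2 s f) (fun s => ?_) ?_
  · refine Eventually.of_forall fun ξ => ?_
    rw [norm_mul, norm_phase, one_mul]
  · filter_upwards [fourier_freeL2 t f] with ξ h
    rw [h]
    refine Tendsto.mul_const _ ?_
    have : Continuous fun s => phase s ξ := by unfold phase; fun_prop
    exact this.tendsto t

theorem hasDerivAt_phase (ξ : ℝ) :
    HasDerivAt (fun t => phase t ξ) (-((2 * Real.pi * ξ) ^ 2 * Complex.I)) 0 := by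
  have h : HasDerivAt (fun t : ℝ => (((-(t * (2 * Real.pi * ξ) ^ 2) : ℝ) : ℂ) * Complex.I))
      (-((2 * Real.pi * ξ) ^ 2 * Complex.I)) 0 := by
    have h1 : HasDerivAt (fun t : ℝ => -(t * (2 * Real.pi * ξ) ^ 2)) (-(2 * Real.pi * ξ) ^ 2) 0 := by
      simpa using! ((hasDerivAt_id (0 : ℝ)).mul_const ((2 * Real.pi * ξ) ^ 2)).neg
    have h2 := h1.ofReal_comp.mul_const Complex.I
    have e : (-((2 * Real.pi * ξ) ^ 2 * Complex.I) : ℂ) =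
        ((-(2 * Real.pi * ξ) ^ 2 : ℝ) : ℂ) * Complex.I := by push_cast; ring
    rw [e]
    exact h2
  have := h.cexp
  simpa [phase] using this

theorem norm_phase_sub_one_le (t ξ : ℝ) : ‖phase t ξ - 1‖ ≤ |t| * (2 * Real.pi * ξ) ^ 2 := by
  have := Real.norm_exp_I_mul_ofReal_sub_one_le (x := -(t * (2 * Real.pi * ξ) ^ 2))
  rw [mul_comm] at this
  refine this.trans ?_
  rw [Real.norm_eq_abs, abs_neg, abs_mul, abs_of_nonneg (sq_nonneg (2 * Real.pi * ξ))]

/-- On the Fourier side the difference quotient at time `0` is dominated by `|𝓕 f''|`, because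
`|exp(-isx) - 1| ≤ |s|x` for `x ≥ 0`. Dominated convergence applies. -/
theorem hasDerivAt_freeL2 {f f' f'' : L2} (h : HasWeakDeriv f f') (h' : HasWeakDeriv f' f'')
    (t : ℝ) : HasDerivAt (fun s => freeL2 s f) (Complex.I • freeL2 t f'') t := by
  have h2 : ((𝓕 f'' : L2) : ℝ → ℂ) =ᵐ[volume] fun ξ => -(2 * Real.pi * ξ) ^ 2 * (𝓕 f : L2) ξ := by
    rw [hasWeakDeriv_iff_fourier] at h h'
    filter_upwards [h, h'] with ξ h1 h2
    rw [h2, h1]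
    linear_combination (2 * Real.pi * ξ) ^ 2 * (𝓕 f : L2) ξ * Complex.I_sq
  have h0 : HasDerivAt (fun s => freeL2 s f) (Complex.I • f'') 0 := by
    rw [hasDerivAt_iff_tendsto_slope_zero]
    apply tendsto_of_tendsto_fourier
    refine tendsto_L2_of_dominated (b := 𝓕 f'')
      (a := fun s ξ => s⁻¹ • ((phase s ξ - 1) * (𝓕 f : L2) ξ)) (fun s => ?_) (fun s => ?_) ?_
    · have e : (𝓕 (s⁻¹ • (freeL2 (0 + s) f - freeL2 0 f)) : L2) =
          (s⁻¹ : ℂ) • ((𝓕 (freeL2 s f) : L2) - 𝓕 f) := by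
        have e1 : s⁻¹ • (freeL2 (0 + s) f - freeL2 0 f) = (s⁻¹ : ℂ) • (freeL2 s f - f) := by
          rw [zero_add, freeL2_zero, ← Complex.ofReal_inv, Complex.coe_smul]
          rfl
        rw [e1, FourierTransform.fourier_smul]
        congr 1
        exact (Lp.fourierTransformₗᵢ ℝ ℂ).map_sub _ _
      rw [e]
      filter_upwards [Lp.coeFn_smul (s⁻¹ : ℂ) ((𝓕 (freeL2 s f) : L2) - 𝓕 f),
        Lp.coeFn_sub (𝓕 (freeL2 s f) : L2) (𝓕 f), fourier_freeL2 s f] with ξ h3 h4 h5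
      rw [h3, Pi.smul_apply, h4, Pi.sub_apply, h5, Complex.real_smul, smul_eq_mul]
      push_cast
      ring
    · filter_upwards [h2] with ξ h2
      rw [h2, norm_smul, norm_mul, norm_mul, norm_neg, norm_inv, ← mul_assoc]
      refine mul_le_mul_of_nonneg_right ?_ (norm_nonneg _)
      have e : ‖((2 * Real.pi * ξ : ℂ)) ^ 2‖ = (2 * Real.pi * ξ) ^ 2 := by
        rw [← Complex.ofReal_ofNat, ← Complex.ofReal_mul, ← Complex.ofReal_mul,
          ← Complex.ofReal_pow, Complex.norm_real, Real.norm_of_nonneg (sq_nonneg _)]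
      rw [e]
      rcases eq_or_ne s 0 with rfl | hs
      · simp; positivity
      · rw [inv_mul_le_iff₀ (by positivity)]
        exact norm_phase_sub_one_le s ξ
    · have e : (𝓕 (Complex.I • f'') : L2) = Complex.I • (𝓕 f'' : L2) :=
        FourierTransform.fourier_smul _ _
      rw [e]
      filter_upwards [Lp.coeFn_smul Complex.I (𝓕 f'' : L2), h2] with ξ h3 h4
      rw [h3, Pi.smul_apply, h4]
      have := (hasDerivAt_phase ξ).tendsto_slope_zero
      have h5 := this.mul_const ((𝓕 f : L2) ξ)
      have e1 : Complex.I • (-(2 * Real.pi * ξ : ℂ) ^ 2 * (𝓕 f : L2) ξ) =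
        -((2 * Real.pi * ξ) ^ 2 * Complex.I) * (𝓕 f : L2) ξ := by
        rw [smul_eq_mul]; ring
      rw [e1]
      refine h5.congr fun s => ?_
      simp [phase, mul_assoc]
  -- The group law carries the derivative from time `0` to time `t`.
  have h1 := (freeL2 t).restrictScalars ℝ |>.hasFDerivAt.comp_hasDerivAt (0 : ℝ) h0
  have h3 : HasDerivAt (fun s => freeL2 t (freeL2 (s - t) f)) (freeL2 t (Complex.I • f'')) t := by
    have h4 : HasDerivAt (fun s => freeL2 t (freeL2 s f)) (freeL2 t (Complex.I • f'')) (t - t) := by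
      rw [sub_self]; exact h1
    have h5 := HasDerivAt.scomp (h := fun s => s - t) t h4 ((hasDerivAt_id t).sub_const t)
    simpa using! h5
  rw [map_smul] at h3
  refine h3.congr_of_eventuallyEq (Eventually.of_forall fun s => ?_)
  simp only [freeL2_freeL2, add_sub_cancel]

/-! ### The spaces `H^k`: chains of weak derivatives, completeness, inclusion and differentiation.
-/

instance : NormedAddCommGroup (H k) := inferInstance
instance : InnerProductSpace ℂ (H k) := inferInstance
instance : NormedSpace ℂ (H k) := inferInstance
instance : Module ℂ (H k) := inferInstance
instance : MulAction ℂ (H k) := inferInstance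

theorem isWeakDeriv_zero (f : L2) : IsWeakDeriv 0 f f := rfl

theorem IsWeakDeriv.succ {i : ℕ} {f g h : L2} (h₁ : IsWeakDeriv i f g) (h₂ : HasWeakDeriv g h) :
    IsWeakDeriv (i + 1) f h := by
  unfold IsWeakDeriv at h₁ ⊢
  rw [Function.iterate_succ_apply', h₁]
  exact h₂

theorem H.hasWeakDeriv (u : H (k + 1)) (i : Fin (k + 1)) :
    HasWeakDeriv (u.1 i.castSucc) (u.1 i.succ) := by
  have h₁ := u.2 i.castSucc
  have h₂ := u.2 i.succ
  unfold IsWeakDeriv at h₁ h₂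
  rw [Fin.val_succ, Function.iterate_succ_apply'] at h₂
  rw [Fin.val_castSucc] at h₁
  rw [h₁] at h₂
  exact h₂

/-- An element of `H^k` built from a chain of weak derivatives. -/
def H.ofChain (F : Fin (k + 1) → L2)
    (hF : ∀ i : Fin k, HasWeakDeriv (F i.castSucc) (F i.succ)) : H k :=
  ⟨WithLp.toLp 2 F, by
    intro i
    induction i using Fin.induction with
    | zero => exact isWeakDeriv_zero _
    | succ i ih => exact IsWeakDeriv.succ ih (hF i)⟩

@[simp]
theorem H.ofChain_apply (F : Fin (k + 1) → L2)
    (hF : ∀ i : Fin k, HasWeakDeriv (F i.castSucc) (F i.succ)) (i : Fin (k + 1)) :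
    (H.ofChain F hF).1 i = F i := rfl

/-- Since the function determines its weak derivatives, every identity in `H^k` can be checked on
component `0` alone. -/
theorem H.ext {u w : H k} (h : u.1 0 = w.1 0) : u = w := by
  apply Subtype.ext
  ext1 i
  have h₁ := u.2 i
  have h₂ := w.2 i
  unfold IsWeakDeriv at h₁ h₂
  rw [h] at h₁
  exact toTemperedDistribution_injective (h₁.symm.trans h₂)

theorem H.norm_sq (u : H k) : ‖u‖ ^ 2 = ∑ i, ‖u.1 i‖ ^ 2 := PiLp.norm_sq_eq_of_L2 _ u.1

theorem H.norm_comp_le (u : H k) (i : Fin (k + 1)) : ‖u.1 i‖ ≤ ‖u‖ := PiLp.norm_apply_le u.1 i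

/-- The `i`-th weak derivative as a continuous linear map. -/
def H.comp (i : Fin (k + 1)) : H k →L[ℂ] L2 := (PiLp.proj 2 _ i) ∘L (H k).subtypeL

@[simp]
theorem H.comp_apply (i : Fin (k + 1)) (u : H k) : H.comp i u = u.1 i := rfl

instance : CompleteSpace (H k) := by
  have h : IsClosed ((H k : Submodule ℂ (PiLp 2 (fun _ : Fin (k + 1) => L2))) :
      Set (PiLp 2 (fun _ : Fin (k + 1) => L2))) := by
    have e : ((H k : Submodule ℂ (PiLp 2 (fun _ : Fin (k + 1) => L2))) :
        Set (PiLp 2 (fun _ : Fin (k + 1) => L2))) =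
        ⋂ i : Fin (k + 1), {F | (TemperedDistribution.derivCLM ℂ)^[i]
          (Lp.toTemperedDistributionCLM ℂ volume 2 (F 0)) =
          Lp.toTemperedDistributionCLM ℂ volume 2 (F i)} := by
      ext F
      simp only [mem_iInter]
      rfl
    rw [e]
    refine isClosed_iInter fun i => isClosed_eq ?_ (by fun_prop)
    exact ((TemperedDistribution.derivCLM ℂ).continuous.iterate i).comp (by fun_prop)
  exact h.completeSpace_coe

/-- The inclusion `H^{k+1} → H^k`. -/
def H.incl : H (k + 1) →L[ℂ] H k :=
  LinearMap.mkContinuous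
    { toFun := fun u => H.ofChain (fun i => u.1 i.castSucc)
        (fun i => by simpa using! H.hasWeakDeriv u i.castSucc)
      map_add' := fun _ _ => rfl
      map_smul' := fun _ _ => rfl } 1 (by
    intro u
    rw [one_mul]
    rw [← sq_le_sq₀ (norm_nonneg _) (norm_nonneg _)]
    rw [H.norm_sq, H.norm_sq, Fin.sum_univ_castSucc (n := k + 1)]
    exact le_add_of_nonneg_right (sq_nonneg _))

/-- The weak derivative `H^{k+1} → H^k`. -/
def H.der : H (k + 1) →L[ℂ] H k :=
  LinearMap.mkContinuous
    { toFun := fun u => H.ofChain (fun i => u.1 i.succ)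
        (fun i => by simpa using! H.hasWeakDeriv u i.succ)
      map_add' := fun _ _ => rfl
      map_smul' := fun _ _ => rfl } 1 (by
    intro u
    rw [one_mul]
    rw [← sq_le_sq₀ (norm_nonneg _) (norm_nonneg _)]
    rw [H.norm_sq, H.norm_sq, Fin.sum_univ_succ (n := k + 1)]
    exact le_add_of_nonneg_left (sq_nonneg _))

@[simp]
theorem H.incl_apply (u : H (k + 1)) (i : Fin (k + 1)) : (H.incl u).1 i = u.1 i.castSucc := rfl

@[simp]
theorem H.der_apply (u : H (k + 1)) (i : Fin (k + 1)) : (H.der u).1 i = u.1 i.succ := rfl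

/-- The splitting behind the inductions on `k`: the `H^{k+1}` norm is the `L²` norm of the function
together with the `H^k` norm of its derivative. -/
theorem H.norm_sq_eq_der (u : H (k + 1)) : ‖u‖ ^ 2 = ‖u.1 0‖ ^ 2 + ‖H.der u‖ ^ 2 := by
  rw [H.norm_sq, H.norm_sq, Fin.sum_univ_succ]
  rfl

theorem H.norm_incl_le (u : H (k + 1)) : ‖H.incl u‖ ≤ ‖u‖ := by
  rw [← sq_le_sq₀ (norm_nonneg _) (norm_nonneg _)]
  rw [H.norm_sq, H.norm_sq, Fin.sum_univ_castSucc (n := k + 1)]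
  exact le_add_of_nonneg_right (sq_nonneg _)

theorem H.norm_der_le (u : H (k + 1)) : ‖H.der u‖ ≤ ‖u‖ := by
  rw [← sq_le_sq₀ (norm_nonneg _) (norm_nonneg _)]
  rw [H.norm_sq_eq_der]
  exact le_add_of_nonneg_left (sq_nonneg _)

theorem H.norm_le_der (u : H (k + 1)) : ‖u‖ ≤ ‖u.1 0‖ + ‖H.der u‖ := by
  rw [← sq_le_sq₀ (norm_nonneg _) (by positivity)]
  rw [H.norm_sq_eq_der]
  nlinarith [norm_nonneg (u.1 0), norm_nonneg (H.der u)]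

/-- Prepend an antiderivative to an element of `H^k`. -/
def H.cons (f : L2) (F : H k) (h : HasWeakDeriv f (F.1 0)) : H (k + 1) :=
  H.ofChain (Fin.cons f F.1) (by
    intro i
    induction i using Fin.cases with
    | zero => exact h
    | succ i =>
      cases k with
      | zero => exact i.elim0
      | succ k => exact H.hasWeakDeriv F i)

theorem H.norm_cons_le (f : L2) (F : H k) (h : HasWeakDeriv f (F.1 0)) :
    ‖H.cons f F h‖ ≤ ‖f‖ + ‖F‖ := H.norm_le_der _

/-! ### The free group on `H^k`. -/

/-- The free Schrödinger group on `H^k`. -/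
def freeH (t : ℝ) : H k →L[ℂ] H k :=
  LinearMap.mkContinuous
    { toFun := fun u => H.ofChain (fun i => freeL2 t (u.1 i)) (fun i => by
        cases k with
        | zero => exact i.elim0
        | succ k => exact (H.hasWeakDeriv u i).freeL2 t)
      map_add' := fun u w => H.ext (map_add (freeL2 t) (u.1 0) (w.1 0))
      map_smul' := fun c u => H.ext (map_smul (freeL2 t) c (u.1 0)) } 1 (by
    intro u
    rw [one_mul]
    rw [← sq_le_sq₀ (norm_nonneg _) (norm_nonneg _)]
    rw [H.norm_sq, H.norm_sq]
    exact le_of_eq (Finset.sum_congr rfl fun i _ => by simp [norm_freeL2]))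

@[simp]
theorem freeH_apply (t : ℝ) (u : H k) (i : Fin (k + 1)) : (freeH t u).1 i = freeL2 t (u.1 i) := rfl

theorem norm_freeH (t : ℝ) (u : H k) : ‖freeH t u‖ = ‖u‖ := by
  rw [← sq_eq_sq₀ (norm_nonneg _) (norm_nonneg _), H.norm_sq, H.norm_sq]
  simp [norm_freeL2]

theorem freeH_zero (u : H k) : freeH 0 u = u := H.ext (freeL2_zero _)

theorem incl_freeH (t : ℝ) (u : H (k + 1)) : H.incl (freeH t u) = freeH t (H.incl u) := rfl

theorem continuous_freeH_left (u : H k) : Continuous fun t => freeH t u := by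
  rw [continuous_induced_rng]
  refine (PiLp.continuous_toLp 2 _).comp (continuous_pi fun i => ?_)
  exact continuous_freeL2 (u.1 i)

/-- Strong continuity in `t` becomes joint continuity because each `freeH t` is an isometry: `freeH
s w = freeH s (w - u) + freeH s u`, and the first term has norm `‖w - u‖`. -/
theorem continuous_freeH : Continuous fun p : ℝ × H k => freeH p.1 p.2 := by
  rw [continuous_iff_continuousAt]
  rintro ⟨t, u⟩
  have h : Tendsto (fun p : ℝ × H k => freeH p.1 (p.2 - u) + freeH p.1 u) (𝓝 (t, u))
      (𝓝 (0 + freeH t u)) := by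
    refine Tendsto.add ?_ ?_
    · rw [tendsto_zero_iff_norm_tendsto_zero]
      simp only [norm_freeH]
      have : Continuous fun p : ℝ × H k => ‖p.2 - u‖ := by fun_prop
      simpa using this.tendsto (t, u)
    · exact ((continuous_freeH_left u).comp continuous_fst).tendsto (t, u)
  rw [zero_add] at h
  refine h.congr fun p => ?_
  rw [← map_add, sub_add_cancel]

/-! ### Conjugation, density of Schwartz functions in `H^1`, and the Sobolev embedding. -/

/-- Complex conjugation of Schwartz functions. -/
def conjSchwartz (ψ : 𝓢(ℝ, ℂ)) : 𝓢(ℝ, ℂ) :=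
  SchwartzMap.postcompCLM (𝕜 := ℝ) (Complex.conjCLE : ℂ →L[ℝ] ℂ) ψ

@[simp]
theorem conjSchwartz_apply (ψ : 𝓢(ℝ, ℂ)) (x : ℝ) :
    conjSchwartz ψ x = (starRingEnd ℂ) (ψ x) := rfl

theorem deriv_conjSchwartz (ψ : 𝓢(ℝ, ℂ)) (x : ℝ) :
    deriv (conjSchwartz ψ) x = (starRingEnd ℂ) (deriv ψ x) := by
  have h := ψ.differentiableAt.hasDerivAt (x := x)
  exact ((Complex.conjCLE : ℂ →L[ℝ] ℂ).hasFDerivAt.comp_hasDerivAt x h).deriv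

theorem hasWeakDeriv_star {f g : L2} (h : HasWeakDeriv f g) : HasWeakDeriv (star f) (star g) := by
  rw [hasWeakDeriv_iff] at h ⊢
  intro ψ
  have h₁ := congrArg (starRingEnd ℂ) (h (conjSchwartz ψ))
  rw [map_neg, ← integral_conj, ← integral_conj] at h₁
  simp only [deriv_conjSchwartz, conjSchwartz_apply, map_mul, Complex.conj_conj] at h₁
  calc _ = ∫ x, deriv ψ x * (starRingEnd ℂ) (f x) := by
        refine integral_congr_ae ?_
        filter_upwards [Lp.coeFn_star f] with x hx
        rw [hx]; rfl
    _ = -∫ x, ψ x * (starRingEnd ℂ) (g x) := h₁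
    _ = _ := by
        congr 1
        refine integral_congr_ae ?_
        filter_upwards [Lp.coeFn_star g] with x hx
        rw [hx]; rfl

/-- Complex conjugation on `H^k`. -/
def conjH (u : H k) : H k :=
  H.ofChain (fun i => star (u.1 i)) (fun i => by
    cases k with
    | zero => exact i.elim0
    | succ k => exact hasWeakDeriv_star (H.hasWeakDeriv u i))

@[simp]
theorem conjH_apply (u : H k) (i : Fin (k + 1)) : (conjH u).1 i = star (u.1 i) := rfl

theorem star_sub_L2 (f g : L2) : star (f - g) = star f - star g := by
  apply Lp.ext
  filter_upwards [Lp.coeFn_sub f g, Lp.coeFn_star (f - g), Lp.coeFn_sub (star f) (star g),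
    Lp.coeFn_star f, Lp.coeFn_star g] with x h₁ h₂ h₃ h₄ h₅
  rw [h₂, h₃, Pi.sub_apply, h₄, h₅, Pi.star_apply, h₁]
  simp

theorem norm_star_L2 (f : L2) : ‖star f‖ = ‖f‖ := by
  refine le_antisymm (norm_L2_le_of_ae ?_) (norm_L2_le_of_ae ?_) <;>
  · filter_upwards [Lp.coeFn_star f] with x h
    simp [h]

theorem conjH_sub (u w : H k) : conjH (u - w) = conjH u - conjH w :=
  H.ext (star_sub_L2 (u.1 0) (w.1 0))

theorem norm_conjH (u : H k) : ‖conjH u‖ = ‖u‖ := by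
  rw [← sq_eq_sq₀ (norm_nonneg _) (norm_nonneg _), H.norm_sq, H.norm_sq]
  exact Finset.sum_congr rfl fun i _ => by rw [conjH_apply, norm_star_L2]

/-- Schwartz functions as elements of `H^1`. -/
def schwartzH1 : 𝓢(ℝ, ℂ) →ₗ[ℂ] H 1 where
  toFun ψ := H.ofChain ![schwartzL2 ψ, schwartzL2 (SchwartzMap.derivCLM ℂ ℂ ψ)] (fun i => by
    rw [Subsingleton.elim i 0]
    exact hasWeakDeriv_schwartz ψ)
  map_add' ψ χ := H.ext (map_add (SchwartzMap.toLpCLM ℂ ℂ 2 volume) ψ χ)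
  map_smul' c ψ := H.ext (map_smul (SchwartzMap.toLpCLM ℂ ℂ 2 volume) c ψ)

@[simp]
theorem schwartzH1_zero (ψ : 𝓢(ℝ, ℂ)) : (schwartzH1 ψ).1 0 = schwartzL2 ψ := rfl

@[simp]
theorem schwartzH1_one (ψ : 𝓢(ℝ, ℂ)) :
    (schwartzH1 ψ).1 1 = schwartzL2 (SchwartzMap.derivCLM ℂ ℂ ψ) := rfl

theorem H.inner_H1 (u w : H 1) :
    inner ℂ u w = inner ℂ (u.1 0) (w.1 0) + inner ℂ (u.1 1) (w.1 1) := by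
  rw [Submodule.coe_inner, PiLp.inner_apply, Fin.sum_univ_two]

/-- If `u` is orthogonal in `H^1` to all Schwartz functions, then `u'' = u` weakly. On the Fourier
side this is `(1 + (2πξ)²)û = 0`, hence `u = 0`. -/
theorem denseRange_schwartzH1 : DenseRange schwartzH1 := by
  have h : (LinearMap.range schwartzH1).topologicalClosure = ⊤ := by
    rw [Submodule.topologicalClosure_eq_top_iff, Submodule.eq_bot_iff]
    intro u hu
    rw [Submodule.mem_orthogonal] at hu
    have h₁ : HasWeakDeriv (u.1 0) (u.1 1) := H.hasWeakDeriv u 0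
    have h₂ : HasWeakDeriv (u.1 1) (u.1 0) := by
      rw [hasWeakDeriv_iff]
      intro ψ
      have h₃ := hu _ (LinearMap.mem_range_self schwartzH1 (conjSchwartz ψ))
      rw [H.inner_H1, schwartzH1_zero, schwartzH1_one, integral_schwartz_mul_eq_inner,
        integral_schwartz_mul_eq_inner] at h₃
      simp only [conjSchwartz_apply, SchwartzMap.derivCLM_apply, deriv_conjSchwartz,
        Complex.conj_conj] at h₃
      rw [eq_neg_iff_add_eq_zero, add_comm]
      simpa only [mul_comm] using h₃
    apply H.ext
    apply L2_ext_fourier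
    rw [hasWeakDeriv_iff_fourier] at h₁ h₂
    have h0 : (𝓕 ((0 : H 1).1 0) : L2) = 0 := (Lp.fourierTransformₗᵢ ℝ ℂ).map_zero
    rw [h0]
    filter_upwards [h₁, h₂, Lp.coeFn_zero ℂ 2 (volume : Measure ℝ)] with ξ h₁ h₂ h₃
    rw [h₃, Pi.zero_apply]
    rw [h₁] at h₂
    have h4 : ((1 + (2 * Real.pi * ξ) ^ 2 : ℝ) : ℂ) * (𝓕 (u.1 0) : L2) ξ = 0 := by
      push_cast
      linear_combination h₂ + (2 * Real.pi * ξ) ^ 2 * (𝓕 (u.1 0) : L2) ξ * Complex.I_sq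
    refine (mul_eq_zero.1 h4).resolve_left ?_
    exact Complex.ofReal_ne_zero.2 (by positivity)
  rw [DenseRange, ← LinearMap.coe_range, Submodule.dense_iff_topologicalClosure_eq_top]
  exact h

/-- Integrate `(|ψ|²)' = 2 Re(ψ̄ψ') ≤ |ψ|² + |ψ'|²` from `-∞` to `x`. -/
theorem norm_sq_schwartz_le (ψ : 𝓢(ℝ, ℂ)) (x : ℝ) : ‖ψ x‖ ^ 2 ≤ ‖schwartzH1 ψ‖ ^ 2 := by
  set χ := SchwartzMap.derivCLM ℂ ℂ ψ with hχ
  have i₁ := integrable_norm_sq_L2 (schwartzL2 ψ)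
  have i₂ := integrable_norm_sq_L2 (schwartzL2 χ)
  have e₁ : (fun x => ‖schwartzL2 ψ x‖ ^ 2) =ᵐ[volume] fun x => ‖ψ x‖ ^ 2 := by
    filter_upwards [ψ.coeFn_toLp 2 volume] with x hx
    rw [hx]
  have e₂ : (fun x => ‖schwartzL2 χ x‖ ^ 2) =ᵐ[volume] fun x => ‖χ x‖ ^ 2 := by
    filter_upwards [χ.coeFn_toLp 2 volume] with x hx
    rw [hx]
  have j₁ := i₁.congr e₁
  have j₂ := i₂.congr e₂
  have hd : ∀ y ∈ Iic x, HasDerivAt (fun y => ‖ψ y‖ ^ 2) (2 * inner ℝ (ψ y) (χ y)) y := by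
    intro y _
    exact (ψ.differentiableAt.hasDerivAt (x := y)).norm_sq
  have hb : ∀ y, ‖2 * inner ℝ (ψ y) (χ y)‖ ≤ ‖ψ y‖ ^ 2 + ‖χ y‖ ^ 2 := by
    intro y
    rw [norm_mul, Real.norm_ofNat]
    have := norm_inner_le_norm (𝕜 := ℝ) (ψ y) (χ y)
    nlinarith [sq_nonneg (‖ψ y‖ - ‖χ y‖)]
  have hi : Integrable (fun y => 2 * inner ℝ (ψ y) (χ y)) :=
    (j₁.add j₂).mono' (Continuous.aestronglyMeasurable (by fun_prop)) (Eventually.of_forall hb)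
  have ht : Tendsto (fun y => ‖ψ y‖ ^ 2) atBot (𝓝 0) := by
    have := (ψ.tendsto_cocompact.mono_left atBot_le_cocompact).norm.pow 2
    simpa using this
  have hF := integral_Iic_of_hasDerivAt_of_tendsto' hd hi.integrableOn ht
  rw [sub_zero] at hF
  rw [← hF, H.norm_sq, Fin.sum_univ_two, schwartzH1_zero, schwartzH1_one, norm_sq_L2, norm_sq_L2,
    integral_congr_ae e₁, integral_congr_ae e₂, ← integral_add j₁ j₂]
  calc _ ≤ ∫ y in Iic x, (‖ψ y‖ ^ 2 + ‖χ y‖ ^ 2) := by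
        refine setIntegral_mono hi.integrableOn (j₁.add j₂).integrableOn ?_
        intro y
        exact (le_abs_self _).trans (hb y)
    _ ≤ _ := setIntegral_le_integral (j₁.add j₂) (Eventually.of_forall fun y => by
        simp only [Pi.zero_apply]; positivity)

theorem norm_toLp_top_schwartz_le (ψ : 𝓢(ℝ, ℂ)) :
    ‖SchwartzMap.toLpCLM ℂ ℂ ∞ volume ψ‖ ≤ 1 * ‖schwartzH1 ψ‖ := by
  rw [one_mul]
  have h : SchwartzMap.toLpCLM ℂ ℂ ∞ volume ψ = ψ.toLp ∞ := rfl
  rw [h, Lp.norm_def]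
  apply ENNReal.toReal_le_of_le_ofReal (norm_nonneg _)
  refine eLpNormEssSup_le_of_ae_bound ?_
  filter_upwards [ψ.coeFn_toLp ∞ volume] with x hx
  rw [hx, ← sq_le_sq₀ (norm_nonneg _) (norm_nonneg _)]
  exact norm_sq_schwartz_le ψ x

/-- The Sobolev embedding `H^1 → L^∞`. -/
def supH1 : H 1 →L[ℂ] Lp ℂ ∞ (volume : Measure ℝ) :=
  LinearMap.extendOfNorm (SchwartzMap.toLpCLM ℂ (E := ℝ) ℂ ∞ volume).toLinearMap schwartzH1

theorem supH1_schwartz (ψ : 𝓢(ℝ, ℂ)) : supH1 (schwartzH1 ψ) = ψ.toLp ∞ :=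
  LinearMap.extendOfNorm_eq denseRange_schwartzH1 ⟨1, norm_toLp_top_schwartz_le⟩ ψ

theorem norm_supH1_le (u : H 1) : ‖supH1 u‖ ≤ ‖u‖ := by
  have h : IsClosed {u : H 1 | ‖supH1 u‖ ≤ ‖u‖} := isClosed_le (by fun_prop) (by fun_prop)
  refine denseRange_schwartzH1.induction_on u h fun ψ => ?_
  have := norm_toLp_top_schwartz_le ψ
  rw [one_mul] at this
  simp only [supH1_schwartz]
  exact this

/-- The extension by density is an abstract element of `L^∞`. Equality as tempered distributions is
a closed condition that holds on Schwartz functions, and it identifies the extension with `u`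
itself. -/
theorem coeFn_supH1 (u : H 1) : supH1 u =ᵐ[volume] u.1 0 := by
  have h : Lp.toTemperedDistributionCLM ℂ volume ∞ (supH1 u) =
      Lp.toTemperedDistributionCLM ℂ volume 2 (H.comp 0 u) := by
    have hc : IsClosed {u : H 1 | Lp.toTemperedDistributionCLM ℂ volume ∞ (supH1 u) =
      Lp.toTemperedDistributionCLM ℂ volume 2 (H.comp 0 u)} :=
      isClosed_eq (by fun_prop) (by fun_prop)
    refine denseRange_schwartzH1.induction_on u hc fun ψ => ?_
    simp only [supH1_schwartz, H.comp_apply, schwartzH1_zero, Lp.toTemperedDistributionCLM_apply]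
    rw [Lp.toTemperedDistribution_toLp_eq, Lp.toTemperedDistribution_toLp_eq]
  refine ae_eq_of_forall_integral_schwartz ((Lp.memLp _).locallyIntegrable le_top)
    (locallyIntegrable_L2 _) fun ψ => ?_
  have := congrArg (fun T => T ψ) h
  simpa only [Lp.toTemperedDistributionCLM_apply, Lp.toTemperedDistribution_apply,
    smul_eq_mul, H.comp_apply] using this

/-! ### Product rule, algebra property and tame product estimate. -/

theorem integrable_schwartz_mul (ψ : 𝓢(ℝ, ℂ)) (f : L2) : Integrable fun x => ψ x * f x :=
  (ψ.memLp 2).integrable_mul (Lp.memLp f)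

/-- If `ψ` is Schwartz then so is `aψ`. Testing `f' ` against `aψ` and expanding `(aψ)'` gives the
Leibniz rule; it serves both Schwartz factors and plane waves. -/
theorem HasWeakDeriv.mul_of_hasTemperateGrowth {a a' : ℝ → ℂ} (ha : a.HasTemperateGrowth)
    (hd : ∀ x, HasDerivAt a (a' x) x) {f f' p q : L2} (h : HasWeakDeriv f f')
    (hp : p =ᵐ[volume] fun x => a x * f x)
    (hq : q =ᵐ[volume] fun x => a' x * f x + a x * f' x) : HasWeakDeriv p q := by
  rw [hasWeakDeriv_iff] at h ⊢
  intro ψ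
  have h₁ := h (SchwartzMap.smulLeftCLM ℂ a ψ)
  have e : ∀ x, SchwartzMap.smulLeftCLM ℂ a ψ x = a x * ψ x := fun x =>
    SchwartzMap.smulLeftCLM_apply_apply ha ψ x
  have e' : ∀ x, deriv (SchwartzMap.smulLeftCLM ℂ a ψ) x = a' x * ψ x + a x * deriv ψ x := by
    intro x
    have : (SchwartzMap.smulLeftCLM ℂ a ψ : ℝ → ℂ) = fun x => a x * ψ x := funext e
    rw [this]
    exact ((hd x).mul (ψ.differentiableAt.hasDerivAt)).deriv
  rw [eq_neg_iff_add_eq_zero] at h₁ ⊢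
  refine (integral_add (integrable_schwartz_mul (SchwartzMap.derivCLM ℂ ℂ ψ) p)
    (integrable_schwartz_mul ψ q)).symm.trans ?_
  refine Eq.trans ?_ ((integral_add (integrable_schwartz_mul (SchwartzMap.derivCLM ℂ ℂ
    (SchwartzMap.smulLeftCLM ℂ a ψ)) f) (integrable_schwartz_mul _ f')).trans h₁)
  refine integral_congr_ae ?_
  filter_upwards [hp, hq] with x hp hq
  simp only [SchwartzMap.derivCLM_apply]
  rw [hp, hq, e, e']
  ring

/-- For Schwartz `u` this is the previous Leibniz rule. Both sides are continuous in `u` for the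
`H^1` norm, thanks to `supH1`, so density finishes. -/
theorem hasWeakDeriv_mul (u w : H 1) :
    HasWeakDeriv (mulL2 (supH1 u) (w.1 0))
      (mulL2 (supH1 w) (u.1 1) + mulL2 (supH1 u) (w.1 1)) := by
  have hc : IsClosed {u : H 1 | HasWeakDeriv (mulL2 (supH1 u) (w.1 0))
      (mulL2 (supH1 w) (H.comp 1 u) + mulL2 (supH1 u) (w.1 1))} :=
    isClosed_hasWeakDeriv.preimage (f := fun u : H 1 => (mulL2 (supH1 u) (w.1 0),
      mulL2 (supH1 w) (H.comp 1 u) + mulL2 (supH1 u) (w.1 1))) (by fun_prop)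
  refine denseRange_schwartzH1.induction_on u hc fun ψ => ?_
  rw [schwartzH1_one, supH1_schwartz]
  refine HasWeakDeriv.mul_of_hasTemperateGrowth ψ.hasTemperateGrowth
    (a' := deriv ψ) (fun x => ψ.differentiableAt.hasDerivAt) (H.hasWeakDeriv w 0) ?_ ?_
  · filter_upwards [coeFn_mulL2 (ψ.toLp ∞) (w.1 0), ψ.coeFn_toLp ∞ volume] with x h₁ h₂
    rw [h₁, h₂]; rfl
  · filter_upwards [coeFn_mulL2 (ψ.toLp ∞) (w.1 1), ψ.coeFn_toLp ∞ volume,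
      coeFn_mulL2 (supH1 w) (schwartzL2 (SchwartzMap.derivCLM ℂ ℂ ψ)),
      (SchwartzMap.derivCLM ℂ ℂ ψ).coeFn_toLp 2 volume, coeFn_supH1 w,
      Lp.coeFn_add (mulL2 (supH1 w) (schwartzL2 (SchwartzMap.derivCLM ℂ ℂ ψ)))
        (mulL2 (ψ.toLp ∞) (w.1 1))] with x h₁ h₂ h₃ h₄ h₅ h₆
    rw [h₆, Pi.add_apply, h₁, h₂, h₃, h₄, h₅, mul_comm (w.1 0 x)]
    rfl

/-- The inclusion `H^{k+1} → H^1`. -/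
def H.toH1 : H (k + 1) →L[ℂ] H 1 :=
  LinearMap.mkContinuous
    { toFun := fun u => H.ofChain ![u.1 0, u.1 1]
        (fun i => by
          rw [Subsingleton.elim i 0]
          exact H.hasWeakDeriv u 0)
      map_add' := fun _ _ => H.ext rfl
      map_smul' := fun _ _ => H.ext rfl } 1 (by
    intro u
    rw [one_mul, ← sq_le_sq₀ (norm_nonneg _) (norm_nonneg _), H.norm_sq_eq_der u, H.norm_sq,
      Fin.sum_univ_two]
    have := H.norm_comp_le (H.der u) 0
    exact add_le_add_right (pow_le_pow_left₀ (norm_nonneg _) this 2) _)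

theorem H.norm_toH1_le (u : H (k + 1)) : ‖H.toH1 u‖ ≤ ‖u‖ := by
  rw [← sq_le_sq₀ (norm_nonneg _) (norm_nonneg _), H.norm_sq_eq_der u, H.norm_sq,
      Fin.sum_univ_two]
  have := H.norm_comp_le (H.der u) 0
  exact add_le_add_right (pow_le_pow_left₀ (norm_nonneg _) this 2) _

/-- The Sobolev embedding `H^{k+1} → L^∞`. -/
def H.sup : H (k + 1) →L[ℂ] Lp ℂ ∞ (volume : Measure ℝ) := supH1 ∘L H.toH1

theorem H.coeFn_sup (u : H (k + 1)) : H.sup u =ᵐ[volume] u.1 0 := coeFn_supH1 (H.toH1 u)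

theorem H.norm_sup_le (u : H (k + 1)) : ‖H.sup u‖ ≤ ‖u‖ :=
  (norm_supH1_le _).trans (H.norm_toH1_le u)

theorem mulL2_comm_of_ae {a b : Lp ℂ ∞ (volume : Measure ℝ)} {f g : L2}
    (ha : a =ᵐ[volume] f) (hb : b =ᵐ[volume] g) : mulL2 a g = mulL2 b f := by
  apply Lp.ext
  filter_upwards [coeFn_mulL2 a g, coeFn_mulL2 b f, ha, hb] with x h₁ h₂ h₃ h₄
  rw [h₁, h₂, h₃, h₄, mul_comm]

theorem H.hasWeakDeriv_mul (u w : H (k + 1)) :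
    HasWeakDeriv (mulL2 (H.sup u) (w.1 0))
      (mulL2 (H.sup w) (u.1 1) + mulL2 (H.sup u) (w.1 1)) :=
  LugiatoLefever.hasWeakDeriv_mul (H.toH1 u) (H.toH1 w)

/-- Induction through `(uw)' = u'w + uw'`: both products on the right lie one order lower, and
`H.cons` puts `uw` back on top. -/
theorem H.exists_mul (k : ℕ) : ∃ C : ℝ, 0 ≤ C ∧ ∀ u w : H (k + 1), ∃ z : H (k + 1),
    z.1 0 = mulL2 (H.sup u) (w.1 0) ∧ ‖z‖ ≤ C * ‖u‖ * ‖w‖ := by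
  have hmul : ∀ {k l : ℕ} (u : H (k + 1)) (f : L2), ‖mulL2 (H.sup u) f‖ ≤ ‖u‖ * ‖f‖ :=
    fun u f => (norm_mulL2_le _ _).trans (by gcongr; exact H.norm_sup_le u)
  induction k with
  | zero =>
    refine ⟨3, by norm_num, fun u w => ?_⟩
    refine ⟨H.cons (mulL2 (H.sup u) (w.1 0)) (H.ofChain (k := 0)
      (fun _ => mulL2 (H.sup w) (u.1 1) + mulL2 (H.sup u) (w.1 1)) (fun i => i.elim0))
      (H.hasWeakDeriv_mul u w), rfl, ?_⟩
    refine (H.norm_cons_le _ _ _).trans ?_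
    have e : ‖(H.ofChain (k := 0) (fun _ => mulL2 (H.sup w) (u.1 1) + mulL2 (H.sup u) (w.1 1))
        (fun i => i.elim0))‖ = ‖mulL2 (H.sup w) (u.1 1) + mulL2 (H.sup u) (w.1 1)‖ := by
      rw [← sq_eq_sq₀ (norm_nonneg _) (norm_nonneg _), H.norm_sq]
      simp
    rw [e]
    have h₁ := hmul (l := 0) u (w.1 0)
    have h₂ := hmul (l := 0) w (u.1 1)
    have h₃ := hmul (l := 0) u (w.1 1)
    have h₄ := norm_add_le (mulL2 (H.sup w) (u.1 1)) (mulL2 (H.sup u) (w.1 1))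
    have h₅ := mul_le_mul_of_nonneg_left (H.norm_comp_le w 0) (norm_nonneg u)
    have h₆ := mul_le_mul_of_nonneg_left (H.norm_comp_le w 1) (norm_nonneg u)
    have h₇ := mul_le_mul_of_nonneg_left (H.norm_comp_le u 1) (norm_nonneg w)
    linarith
  | succ k ih =>
    obtain ⟨C, hC, ih⟩ := ih
    refine ⟨1 + 2 * C, by positivity, fun u w => ?_⟩
    obtain ⟨a, ha, ha'⟩ := ih (H.der u) (H.incl w)
    obtain ⟨b, hb, hb'⟩ := ih (H.incl u) (H.der w)
    have hd : HasWeakDeriv (mulL2 (H.sup u) (w.1 0)) ((a + b).1 0) := by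
      have e : (a + b).1 0 = mulL2 (H.sup w) (u.1 1) + mulL2 (H.sup u) (w.1 1) := by
        have e₁ : a.1 0 = mulL2 (H.sup w) (u.1 1) := by
          rw [ha]
          exact mulL2_comm_of_ae (H.coeFn_sup (H.der u)) (H.coeFn_sup w)
        have e₂ : b.1 0 = mulL2 (H.sup u) (w.1 1) := hb
        rw [← e₁, ← e₂]
        rfl
      rw [e]
      exact H.hasWeakDeriv_mul u w
    refine ⟨H.cons _ (a + b) hd, rfl, ?_⟩
    refine (H.norm_cons_le _ _ _).trans ?_
    have h₁ := hmul (l := 0) u (w.1 0)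
    have h₂ := norm_add_le a b
    have h₃ : C * ‖H.der u‖ * ‖H.incl w‖ ≤ C * ‖u‖ * ‖w‖ := by
      gcongr
      exacts [H.norm_der_le u, H.norm_incl_le w]
    have h₄ : C * ‖H.incl u‖ * ‖H.der w‖ ≤ C * ‖u‖ * ‖w‖ := by
      gcongr
      exacts [H.norm_incl_le u, H.norm_der_le w]
    have h₅ := mul_le_mul_of_nonneg_left (H.norm_comp_le w 0) (norm_nonneg u)
    linarith

/-- The pointwise product of two elements of `H^{k+1}`. -/
def H.mulFun (u w : H (k + 1)) : H (k + 1) := ((H.exists_mul k).choose_spec.2 u w).choose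

theorem H.mulFun_zero_comp (u w : H (k + 1)) : (H.mulFun u w).1 0 = mulL2 (H.sup u) (w.1 0) :=
  ((H.exists_mul k).choose_spec.2 u w).choose_spec.1

/-- The pointwise product on `H^{k+1}` as a continuous bilinear map. -/
def H.mul : H (k + 1) →L[ℂ] H (k + 1) →L[ℂ] H (k + 1) :=
  LinearMap.mkContinuous₂
    (LinearMap.mk₂ ℂ H.mulFun
      (fun u u' w => H.ext (by
        refine (H.mulFun_zero_comp _ _).trans ?_
        rw [map_add, map_add, add_apply, ← H.mulFun_zero_comp, ← H.mulFun_zero_comp]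
        rfl))
      (fun c u w => H.ext (by
        refine (H.mulFun_zero_comp _ _).trans ?_
        rw [map_smul, map_smul, smul_apply, ← H.mulFun_zero_comp]
        rfl))
      (fun u w w' => H.ext (by
        refine (H.mulFun_zero_comp _ _).trans ?_
        refine (map_add _ (w.1 0) (w'.1 0)).trans ?_
        rw [← H.mulFun_zero_comp, ← H.mulFun_zero_comp]
        rfl))
      (fun c u w => H.ext (by
        refine (H.mulFun_zero_comp _ _).trans ?_
        refine (map_smul _ c (w.1 0)).trans ?_
        rw [← H.mulFun_zero_comp]
        rfl)))
    (H.exists_mul k).choose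
    (fun u w => ((H.exists_mul k).choose_spec.2 u w).choose_spec.2)

theorem H.mul_zero_comp (u w : H (k + 1)) : (H.mul u w).1 0 = mulL2 (H.sup u) (w.1 0) :=
  H.mulFun_zero_comp u w

theorem H.coeFn_mul (u w : H (k + 1)) :
    (H.mul u w).1 0 =ᵐ[volume] fun x => u.1 0 x * w.1 0 x := by
  rw [H.mul_zero_comp]
  filter_upwards [coeFn_mulL2 (H.sup u) (w.1 0), H.coeFn_sup u] with x h₁ h₂
  rw [h₁, h₂]

theorem H.exists_norm_mul_le (k : ℕ) :
    ∃ C : ℝ, 0 ≤ C ∧ ∀ u w : H (k + 1), ‖H.mul u w‖ ≤ C * ‖u‖ * ‖w‖ :=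
  ⟨_, (H.exists_mul k).choose_spec.1,
    fun u w => ((H.exists_mul k).choose_spec.2 u w).choose_spec.2⟩

theorem H.incl_mul (u w : H (k + 2)) :
    H.incl (H.mul u w) = H.mul (H.incl u) (H.incl w) := by
  apply H.ext
  rw [H.mul_zero_comp, H.incl_apply]
  exact H.mul_zero_comp u w

theorem H.der_mul (u w : H (k + 2)) :
    H.der (H.mul u w) = H.mul (H.der u) (H.incl w) + H.mul (H.incl u) (H.der w) := by
  apply H.ext
  have h := H.hasWeakDeriv_mul u w
  rw [← H.mul_zero_comp] at h
  refine (HasWeakDeriv.unique (H.hasWeakDeriv (H.mul u w) 0) h).trans ?_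
  have e₁ : (H.mul (H.der u) (H.incl w)).1 0 = mulL2 (H.sup w) (u.1 1) := by
    rw [H.mul_zero_comp]
    exact mulL2_comm_of_ae (H.coeFn_sup (H.der u)) (H.coeFn_sup w)
  have e₂ : (H.mul (H.incl u) (H.der w)).1 0 = mulL2 (H.sup u) (w.1 1) := H.mul_zero_comp _ _
  rw [← e₁, ← e₂]
  rfl

/-- In `(uw)' = u'w + uw'` the undifferentiated factor enters only through the norm one order below.
The top norm therefore appears linearly, which keeps Grönwall applicable to the higher norms. -/
theorem H.exists_norm_mul_le_tame (k : ℕ) : ∃ C : ℝ, 0 ≤ C ∧ ∀ u w : H (k + 2),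
    ‖H.mul u w‖ ≤ C * (‖u‖ * ‖H.incl w‖ + ‖H.incl u‖ * ‖w‖) := by
  obtain ⟨C, hC, h⟩ := H.exists_norm_mul_le k
  refine ⟨1 + C, by positivity, fun u w => ?_⟩
  refine (H.norm_le_der _).trans ?_
  rw [H.der_mul, H.mul_zero_comp]
  have h₁ := norm_add_le (H.mul (H.der u) (H.incl w)) (H.mul (H.incl u) (H.der w))
  have h₂ := h (H.der u) (H.incl w)
  have h₃ := h (H.incl u) (H.der w)
  have h₄ : C * ‖H.der u‖ * ‖H.incl w‖ ≤ C * ‖u‖ * ‖H.incl w‖ := by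
    gcongr; exact H.norm_der_le u
  have h₅ : C * ‖H.incl u‖ * ‖H.der w‖ ≤ C * ‖H.incl u‖ * ‖w‖ := by
    gcongr; exact H.norm_der_le w
  have h₆ : ‖mulL2 (H.sup u) (w.1 0)‖ ≤ ‖H.incl u‖ * ‖w‖ := by
    refine (norm_mulL2_le _ _).trans ?_
    gcongr
    · exact H.norm_sup_le (H.incl u)
    · exact H.norm_comp_le w 0
  have h₇ : 0 ≤ ‖u‖ * ‖H.incl w‖ := by positivity
  nlinarith

/-! ### Multiplication by the plane wave on `H^k`. -/

/-- The plane wave `exp(-iκξ)`. -/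
def planeWave (κ x : ℝ) : ℂ := Complex.exp (-(Complex.I * κ * x))

theorem norm_planeWave (κ x : ℝ) : ‖planeWave κ x‖ = 1 := by
  have : -(Complex.I * κ * x) = ((-(κ * x) : ℝ) : ℂ) * Complex.I := by push_cast; ring
  rw [planeWave, this, Complex.norm_exp_ofReal_mul_I]

theorem conj_planeWave (κ x : ℝ) : (starRingEnd ℂ) (planeWave κ x) = planeWave (-κ) x := by
  rw [planeWave, planeWave, ← Complex.exp_conj]
  simp

theorem hasDerivAt_planeWave (κ x : ℝ) :
    HasDerivAt (planeWave κ) (-(Complex.I * κ) * planeWave κ x) x := by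
  have h : HasDerivAt (fun x : ℝ => -(Complex.I * κ * x)) (-(Complex.I * κ)) x := by
    simpa using! ((Complex.ofRealCLM.hasDerivAt (x := x)).const_mul (Complex.I * κ)).neg
  have := h.cexp
  rw [mul_comm (Complex.exp _)] at this
  exact this

theorem hasTemperateGrowth_planeWave (κ : ℝ) : (planeWave κ).HasTemperateGrowth := by
  have hd : deriv (planeWave κ) = fun x => -(Complex.I * κ) * planeWave κ x :=
    funext fun x => (hasDerivAt_planeWave κ x).deriv
  have hi : ∀ n, iteratedDeriv n (planeWave κ) = fun x => (-(Complex.I * κ)) ^ n * planeWave κ x := by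
    intro n
    induction n with
    | zero => simp
    | succ n ih =>
      rw [iteratedDeriv_succ, ih]
      funext x
      rw [((hasDerivAt_planeWave κ x).const_mul _).deriv]
      ring
  refine ⟨?_, fun n => ⟨0, |κ| ^ n, fun x => ?_⟩⟩
  · unfold planeWave
    have h : ContDiff ℝ (⊤ : ℕ∞) (fun x : ℝ => -(Complex.I * κ * (x : ℂ))) :=
      (contDiff_const.mul Complex.ofRealCLM.contDiff).neg
    exact h.cexp
  · rw [norm_iteratedFDeriv_eq_norm_iteratedDeriv, hi, norm_mul, norm_planeWave]
    simp

theorem memLp_planeWave (κ : ℝ) : MemLp (planeWave κ) ∞ (volume : Measure ℝ) :=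
  memLp_top_of_bound (by
    have : Continuous (planeWave κ) := by unfold planeWave; fun_prop
    exact this.aestronglyMeasurable) 1
    (Eventually.of_forall fun ξ => (norm_planeWave κ ξ).le)

/-- Multiplication by the plane wave on `L²`. -/
def planeL2 (κ : ℝ) : L2 →L[ℂ] L2 := mulL2 ((memLp_planeWave κ).toLp _)

theorem coeFn_planeL2 (κ : ℝ) (f : L2) : planeL2 κ f =ᵐ[volume] fun x => planeWave κ x * f x := by
  filter_upwards [coeFn_mulL2 ((memLp_planeWave κ).toLp _) f,
    (memLp_planeWave κ).coeFn_toLp] with ξ h1 h2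
  rw [planeL2, h1, h2]

theorem norm_planeL2_le (κ : ℝ) (f : L2) : ‖planeL2 κ f‖ ≤ ‖f‖ := by
  refine norm_L2_le_of_ae ?_
  filter_upwards [coeFn_planeL2 κ f] with x hx
  rw [hx, norm_mul, norm_planeWave, one_mul]

theorem HasWeakDeriv.planeL2 {f f' : L2} (κ : ℝ) (h : HasWeakDeriv f f') :
    HasWeakDeriv (planeL2 κ f) (planeL2 κ f' + (-(Complex.I * κ)) • planeL2 κ f) := by
  refine h.mul_of_hasTemperateGrowth (hasTemperateGrowth_planeWave κ) (hasDerivAt_planeWave κ)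
    (coeFn_planeL2 κ f) ?_
  filter_upwards [coeFn_planeL2 κ f, coeFn_planeL2 κ f',
    Lp.coeFn_smul (-(Complex.I * κ)) (LugiatoLefever.planeL2 κ f),
    Lp.coeFn_add (LugiatoLefever.planeL2 κ f')
      ((-(Complex.I * κ)) • LugiatoLefever.planeL2 κ f)] with x h₁ h₂ h₃ h₄
  rw [h₄, Pi.add_apply, h₃, Pi.smul_apply, h₁, h₂, smul_eq_mul]
  ring

/-- Induction through `(eu)' = eu' - iκeu` for `e = exp(-iκξ)`. -/
theorem H.exists_plane (κ : ℝ) (k : ℕ) : ∃ C : ℝ, 0 ≤ C ∧ ∀ u : H k, ∃ z : H k,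
    z.1 0 = planeL2 κ (u.1 0) ∧ ‖z‖ ≤ C * ‖u‖ := by
  induction k with
  | zero =>
    refine ⟨1, zero_le_one, fun u => ⟨H.ofChain (fun _ => planeL2 κ (u.1 0)) (fun i => i.elim0),
      rfl, ?_⟩⟩
    rw [one_mul, ← sq_le_sq₀ (norm_nonneg _) (norm_nonneg _), H.norm_sq, H.norm_sq]
    simpa using pow_le_pow_left₀ (norm_nonneg _) (norm_planeL2_le κ (u.1 0)) 2
  | succ k ih =>
    obtain ⟨C, hC, ih⟩ := ih
    refine ⟨1 + (C + |κ| * C), by positivity, fun u => ?_⟩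
    obtain ⟨a, ha, ha'⟩ := ih (H.der u)
    obtain ⟨b, hb, hb'⟩ := ih (H.incl u)
    have hd : HasWeakDeriv (planeL2 κ (u.1 0)) ((a + (-(Complex.I * κ)) • b).1 0) := by
      have e : (a + (-(Complex.I * κ)) • b).1 0 =
          planeL2 κ (u.1 1) + (-(Complex.I * κ)) • planeL2 κ (u.1 0) := by
        have e₁ : a.1 0 = planeL2 κ (u.1 1) := ha
        have e₂ : b.1 0 = planeL2 κ (u.1 0) := hb
        rw [← e₁, ← e₂]
        rfl
      rw [e]
      exact (H.hasWeakDeriv u 0).planeL2 κ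
    refine ⟨H.cons _ _ hd, rfl, ?_⟩
    refine (H.norm_cons_le _ _ _).trans ?_
    have h₁ := norm_add_le a ((-(Complex.I * κ)) • b)
    have h₂ : ‖(-(Complex.I * κ)) • b‖ = |κ| * ‖b‖ := by
      rw [norm_smul]; simp
    have h₃ := mul_le_mul_of_nonneg_left (H.norm_der_le u) hC
    have h₄ := mul_le_mul_of_nonneg_left (H.norm_incl_le u) hC
    have h₅ := mul_le_mul_of_nonneg_left (hb'.trans h₄) (abs_nonneg κ)
    have h₆ := (norm_planeL2_le κ (u.1 0)).trans (H.norm_comp_le u 0)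
    linarith

/-- Multiplication of an element of `H^k` by the plane wave. -/
def H.planeFun (κ : ℝ) (u : H k) : H k := ((H.exists_plane κ k).choose_spec.2 u).choose

theorem H.planeFun_zero_comp (κ : ℝ) (u : H k) : (H.planeFun κ u).1 0 = planeL2 κ (u.1 0) :=
  ((H.exists_plane κ k).choose_spec.2 u).choose_spec.1

/-- Multiplication by the plane wave as a continuous linear map on `H^k`. -/
def H.plane (κ : ℝ) : H k →L[ℂ] H k :=
  LinearMap.mkContinuous
    { toFun := H.planeFun κ
      map_add' := fun u w => H.ext (by
        refine (H.planeFun_zero_comp _ _).trans ?_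
        refine (map_add _ (u.1 0) (w.1 0)).trans ?_
        rw [← H.planeFun_zero_comp, ← H.planeFun_zero_comp]
        rfl)
      map_smul' := fun c u => H.ext (by
        refine (H.planeFun_zero_comp _ _).trans ?_
        refine (map_smul _ c (u.1 0)).trans ?_
        rw [← H.planeFun_zero_comp]
        rfl) }
    (H.exists_plane κ k).choose
    (fun u => ((H.exists_plane κ k).choose_spec.2 u).choose_spec.2)

theorem H.plane_zero_comp (κ : ℝ) (u : H k) : (H.plane κ u).1 0 = planeL2 κ (u.1 0) :=
  H.planeFun_zero_comp κ u

theorem H.coeFn_plane (κ : ℝ) (u : H k) :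
    (H.plane κ u).1 0 =ᵐ[volume] fun x => planeWave κ x * u.1 0 x := by
  rw [H.plane_zero_comp]
  exact coeFn_planeL2 κ _

theorem H.incl_plane (κ : ℝ) (u : H (k + 1)) :
    H.incl (H.plane κ u) = H.plane κ (H.incl u) := by
  apply H.ext
  rw [H.plane_zero_comp]
  exact H.plane_zero_comp κ u

theorem H.mul_comm (u w : H (k + 1)) : H.mul u w = H.mul w u := by
  apply H.ext
  rw [H.mul_zero_comp, H.mul_zero_comp]
  exact mulL2_comm_of_ae (H.coeFn_sup u) (H.coeFn_sup w)

/-! ### The nonlinearity on `H^{k+1}`: identification with `N`, Lipschitz and tame bounds. -/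

namespace Params

variable (P : Params)

theorem η_eq (x : ℝ) : P.η x = P.R * planeWave P.κ x := rfl

/-- The strength `-3λ/2ω` of the nonlinearity. -/
def g : ℝ := -(3 * P.lam / (2 * P.ω))

/-- The density perturbation `|u + η|² - |η|²` as an element of `H^{k+1}`. -/
def density (u : H (k + 1)) : H (k + 1) :=
  H.mul u (conjH u) + P.R • H.plane P.κ (conjH u) + (starRingEnd ℂ P.R) • H.plane (-P.κ) u

/-- The nonlinearity as a map on `H^{k+1}`. -/
def nonlin (u : H (k + 1)) : H (k + 1) :=
  (P.g : ℂ) • (H.mul (P.density u) u + P.R • H.plane P.κ (P.density u))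

/-- The part of the right-hand side of the evolution equation that is bounded on `H^{k+1}`. -/
def force (u : H (k + 1)) : H (k + 1) :=
  (-(P.α / 2) + Complex.I * P.c : ℂ) • u - Complex.I • P.nonlin u

theorem coeFn_density (u : H (k + 1)) : (P.density u).1 0 =ᵐ[volume]
    fun x => ((‖u.1 0 x + P.η x‖ ^ 2 - ‖P.η x‖ ^ 2 : ℝ) : ℂ) := by
  have e : (P.density u).1 0 = (H.mul u (conjH u)).1 0 + P.R • (H.plane P.κ (conjH u)).1 0 +
      (starRingEnd ℂ P.R) • (H.plane (-P.κ) u).1 0 := rfl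
  rw [e]
  filter_upwards [Lp.coeFn_add ((H.mul u (conjH u)).1 0 + P.R • (H.plane P.κ (conjH u)).1 0)
      ((starRingEnd ℂ P.R) • (H.plane (-P.κ) u).1 0),
    Lp.coeFn_add ((H.mul u (conjH u)).1 0) (P.R • (H.plane P.κ (conjH u)).1 0),
    Lp.coeFn_smul P.R ((H.plane P.κ (conjH u)).1 0),
    Lp.coeFn_smul (starRingEnd ℂ P.R) ((H.plane (-P.κ) u).1 0),
    H.coeFn_mul u (conjH u), H.coeFn_plane P.κ (conjH u), H.coeFn_plane (-P.κ) u,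
    Lp.coeFn_star (u.1 0)] with x h₁ h₂ h₃ h₄ h₅ h₆ h₇ h₈
  rw [h₁, Pi.add_apply, h₂, Pi.add_apply, h₃, h₄, Pi.smul_apply, Pi.smul_apply, h₅, h₆, h₇,
    conjH_apply, h₈, Pi.star_apply, η_eq]
  simp only [Complex.sq_norm, Complex.ofReal_sub]
  rw [Complex.normSq_eq_conj_mul_self, Complex.normSq_eq_conj_mul_self]
  simp only [map_add, map_mul, conj_planeWave, smul_eq_mul, Complex.star_def]
  ring

theorem coeFn_nonlin (u : H (k + 1)) : (P.nonlin u).1 0 =ᵐ[volume] P.N (H.fn u) := by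
  have e : (P.nonlin u).1 0 = (P.g : ℂ) • ((H.mul (P.density u) u).1 0 +
      P.R • (H.plane P.κ (P.density u)).1 0) := rfl
  rw [e]
  filter_upwards [Lp.coeFn_smul (P.g : ℂ) ((H.mul (P.density u) u).1 0 +
      P.R • (H.plane P.κ (P.density u)).1 0),
    Lp.coeFn_add ((H.mul (P.density u) u).1 0) (P.R • (H.plane P.κ (P.density u)).1 0),
    Lp.coeFn_smul P.R ((H.plane P.κ (P.density u)).1 0),
    H.coeFn_mul (P.density u) u, H.coeFn_plane P.κ (P.density u),
    P.coeFn_density u] with x h₁ h₂ h₃ h₄ h₅ h₆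
  rw [h₁, Pi.smul_apply, h₂, Pi.add_apply, h₃, Pi.smul_apply, h₄, h₅, h₆, N, H.fn, η_eq, g]
  push_cast
  simp only [smul_eq_mul]
  ring

theorem incl_density (u : H (k + 2)) : H.incl (P.density u) = P.density (H.incl u) := by
  simp only [density, map_add, map_smul, H.incl_mul, H.incl_plane]
  rfl

theorem incl_force (u : H (k + 2)) : H.incl (P.force u) = P.force (H.incl u) := by
  simp only [force, nonlin, map_add, map_sub, map_smul, H.incl_mul, H.incl_plane, incl_density]

/-- A seminorm on `H^{k+1}` for which multiplication by `H^{k+1}` functions is bounded. -/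
structure IsMulBounded (n : Seminorm ℂ (H (k + 1))) (C : ℝ) : Prop where
  nonneg : 0 ≤ C
  mul_le : ∀ u w, n (H.mul u w) ≤ C * ‖u‖ * n w
  plane_le : ∀ u, n (H.plane P.κ u) ≤ C * n u
  plane_neg_le : ∀ u, n (H.plane (-P.κ) u) ≤ C * n u
  conj_eq : ∀ u, n (conjH u) = n u

theorem exists_isMulBounded_norm : ∃ C, P.IsMulBounded (normSeminorm ℂ (H (k + 1))) C := by
  obtain ⟨C, hC, h⟩ := H.exists_norm_mul_le k
  refine ⟨max C (max ‖H.plane (k := k + 1) P.κ‖ ‖H.plane (k := k + 1) (-P.κ)‖), ?_, ?_, ?_, ?_, ?_⟩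
  · exact hC.trans (le_max_left _ _)
  · intro u w
    simp only [coe_normSeminorm]
    refine (h u w).trans ?_
    gcongr
    exact le_max_left _ _
  · intro u
    simp only [coe_normSeminorm]
    refine (ContinuousLinearMap.le_opNorm _ _).trans ?_
    gcongr
    exact (le_max_left _ _).trans (le_max_right _ _)
  · intro u
    simp only [coe_normSeminorm]
    refine (ContinuousLinearMap.le_opNorm _ _).trans ?_
    gcongr
    exact (le_max_right _ _).trans (le_max_right _ _)
  · intro u
    exact norm_conjH u

/-- In a product one factor is placed in `L^∞` by the Sobolev embedding and the other stays in `L²`.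
This second instance of `IsMulBounded` yields the `L²` Lipschitz bound needed for uniqueness, while
the norm itself yields the one needed for existence. -/
theorem isMulBounded_L2 :
    P.IsMulBounded ((normSeminorm ℂ L2).comp (H.comp (k := k + 1) 0).toLinearMap) 1 where
  nonneg := zero_le_one
  mul_le u w := by
    rw [one_mul]
    simp only [Seminorm.comp_apply, coe_normSeminorm, ContinuousLinearMap.coe_coe, H.comp_apply,
      H.mul_zero_comp]
    refine (norm_mulL2_le _ _).trans ?_
    gcongr
    exact H.norm_sup_le u
  plane_le u := by
    rw [one_mul]
    simp only [Seminorm.comp_apply, coe_normSeminorm, ContinuousLinearMap.coe_coe, H.comp_apply,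
      H.plane_zero_comp]
    exact norm_planeL2_le _ _
  plane_neg_le u := by
    rw [one_mul]
    simp only [Seminorm.comp_apply, coe_normSeminorm, ContinuousLinearMap.coe_coe, H.comp_apply,
      H.plane_zero_comp]
    exact norm_planeL2_le _ _
  conj_eq u := norm_star_L2 _

variable {P}

theorem IsMulBounded.density_sub_le {n : Seminorm ℂ (H (k + 1))} {C : ℝ}
    (h : P.IsMulBounded n C) (B : ℝ) (u w : H (k + 1)) (hu : ‖u‖ ≤ B) (hw : ‖w‖ ≤ B) :
    n (P.density u - P.density w) ≤ (2 * C * B + 2 * ‖P.R‖ * C) * n (u - w) := by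
  have hC := h.nonneg
  -- Telescoping `uū - ww̄ = u(ū - w̄) + w̄(u - w)`, so that `u - w` occurs once in each term.
  have e : P.density u - P.density w = H.mul u (conjH (u - w)) + H.mul (conjH w) (u - w) +
      P.R • H.plane P.κ (conjH (u - w)) + (starRingEnd ℂ P.R) • H.plane (-P.κ) (u - w) := by
    rw [H.mul_comm (conjH w)]
    simp only [density, conjH_sub, map_sub, sub_apply, smul_sub]
    abel
  have h0 : 0 ≤ n (u - w) := apply_nonneg n _
  have h₁ : n (H.mul u (conjH (u - w))) ≤ C * B * n (u - w) := by
    refine (h.mul_le _ _).trans ?_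
    rw [h.conj_eq]
    gcongr
  have h₂ : n (H.mul (conjH w) (u - w)) ≤ C * B * n (u - w) := by
    refine (h.mul_le _ _).trans ?_
    rw [norm_conjH]
    gcongr
  have h₃ : n (P.R • H.plane P.κ (conjH (u - w))) ≤ ‖P.R‖ * (C * n (u - w)) := by
    rw [map_smul_eq_mul]
    gcongr
    exact (h.plane_le _).trans (by rw [h.conj_eq])
  have h₄ : n ((starRingEnd ℂ P.R) • H.plane (-P.κ) (u - w)) ≤ ‖P.R‖ * (C * n (u - w)) := by
    rw [map_smul_eq_mul, RCLike.norm_conj]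
    gcongr
    exact h.plane_neg_le _
  rw [e]
  have h₅ := map_add_le_add n (H.mul u (conjH (u - w)) + H.mul (conjH w) (u - w) +
      P.R • H.plane P.κ (conjH (u - w))) ((starRingEnd ℂ P.R) • H.plane (-P.κ) (u - w))
  have h₆ := map_add_le_add n (H.mul u (conjH (u - w)) + H.mul (conjH w) (u - w))
      (P.R • H.plane P.κ (conjH (u - w)))
  have h₇ := map_add_le_add n (H.mul u (conjH (u - w))) (H.mul (conjH w) (u - w))
  linarith

@[simp]
theorem density_zero : P.density (0 : H (k + 1)) = 0 := by
  have : conjH (0 : H (k + 1)) = 0 := by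
    rw [← norm_eq_zero, norm_conjH, norm_zero]
  simp [density, this]

theorem exists_norm_density_le (B : ℝ) : ∃ D : ℝ, 0 ≤ D ∧ ∀ u : H (k + 1), ‖u‖ ≤ B →
    ‖P.density u‖ ≤ D * ‖u‖ := by
  obtain ⟨C, hC⟩ := P.exists_isMulBounded_norm (k := k)
  refine ⟨|2 * C * B + 2 * ‖P.R‖ * C|, abs_nonneg _, fun u hu => ?_⟩
  have := hC.density_sub_le B u 0 hu (by simpa using (norm_nonneg u).trans hu)
  simp only [density_zero, sub_zero, coe_normSeminorm] at this
  exact this.trans (by gcongr; exact le_abs_self _)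

/-- Telescope `ρ_u u - ρ_w w = ρ_u(u - w) + w(ρ_u - ρ_w)`. The seminorm falls only on differences,
and the remaining factors are bounded in `H^{k+1}` by `B`. -/
theorem IsMulBounded.exists_force_sub_le {n : Seminorm ℂ (H (k + 1))} {C : ℝ}
    (h : P.IsMulBounded n C) (B : ℝ) : ∃ L : ℝ, 0 ≤ L ∧ ∀ u w : H (k + 1), ‖u‖ ≤ B → ‖w‖ ≤ B →
      n (P.force u - P.force w) ≤ L * n (u - w) := by
  obtain ⟨D, hD, hD'⟩ := exists_norm_density_le (P := P) (k := k) B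
  have hC := h.nonneg
  set A := 2 * C * B + 2 * ‖P.R‖ * C with hA
  set L := ‖(-(P.α / 2) + Complex.I * P.c : ℂ)‖ +
    ‖(P.g : ℂ)‖ * (C * (D * B) + C * B * A + ‖P.R‖ * (C * A)) with hL
  refine ⟨|L|, abs_nonneg _, fun u w hu hw => ?_⟩
  have h0 : 0 ≤ n (u - w) := apply_nonneg n _
  have hρ := h.density_sub_le B u w hu hw
  rw [← hA] at hρ
  have e : P.force u - P.force w = (-(P.α / 2) + Complex.I * P.c : ℂ) • (u - w) -
      Complex.I • ((P.g : ℂ) • (H.mul (P.density u) (u - w) +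
        H.mul w (P.density u - P.density w) +
        P.R • H.plane P.κ (P.density u - P.density w))) := by
    rw [H.mul_comm w]
    simp only [force, nonlin, map_sub, sub_apply, smul_sub, smul_add]
    abel
  have h₁ : n (H.mul (P.density u) (u - w)) ≤ C * (D * B) * n (u - w) := by
    refine (h.mul_le _ _).trans ?_
    gcongr
    exact (hD' u hu).trans (by gcongr)
  have h₂ : n (H.mul w (P.density u - P.density w)) ≤ C * B * (A * n (u - w)) := by
    refine (h.mul_le _ _).trans ?_
    have := (norm_nonneg w).trans hw
    gcongr
  have h₃ : n (P.R • H.plane P.κ (P.density u - P.density w)) ≤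
      ‖P.R‖ * (C * (A * n (u - w))) := by
    rw [map_smul_eq_mul]
    gcongr
    exact (h.plane_le _).trans (by gcongr)
  have h₄ := map_add_le_add n (H.mul (P.density u) (u - w) + H.mul w (P.density u - P.density w))
    (P.R • H.plane P.κ (P.density u - P.density w))
  have h₅ := map_add_le_add n (H.mul (P.density u) (u - w)) (H.mul w (P.density u - P.density w))
  have h₆ : n (P.force u - P.force w) ≤ L * n (u - w) := by
    rw [e]
    refine (map_sub_le_add n _ _).trans ?_
    rw [map_smul_eq_mul, map_smul_eq_mul, map_smul_eq_mul, Complex.norm_I, one_mul, hL, add_mul,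
      mul_assoc ‖(P.g : ℂ)‖]
    gcongr
    linarith
  exact h₆.trans (by gcongr; exact le_abs_self _)

variable (P)

theorem exists_norm_force_sub_le (B : ℝ) : ∃ L : ℝ, 0 ≤ L ∧ ∀ u w : H (k + 1), ‖u‖ ≤ B → ‖w‖ ≤ B →
    ‖P.force u - P.force w‖ ≤ L * ‖u - w‖ := by
  obtain ⟨C, hC⟩ := P.exists_isMulBounded_norm (k := k)
  exact hC.exists_force_sub_le B

theorem exists_norm_force_sub_comp_le (B : ℝ) : ∃ L : ℝ, 0 ≤ L ∧ ∀ u w : H (k + 1),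
    ‖u‖ ≤ B → ‖w‖ ≤ B → ‖(P.force u - P.force w).1 0‖ ≤ L * ‖(u - w).1 0‖ :=
  P.isMulBounded_L2.exists_force_sub_le B

theorem continuous_of_bounded_lipschitz {E F : Type*} [SeminormedAddCommGroup E]
    [SeminormedAddCommGroup F] {f : E → F}
    (h : ∀ B : ℝ, ∃ L : ℝ, ∀ u w : E, ‖u‖ ≤ B → ‖w‖ ≤ B → ‖f u - f w‖ ≤ L * ‖u - w‖) :
    Continuous f := by
  rw [continuous_iff_continuousAt]
  intro u
  obtain ⟨L, hL⟩ := h (‖u‖ + 1)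
  rw [ContinuousAt, tendsto_iff_norm_sub_tendsto_zero]
  have h₁ : Tendsto (fun w => L * ‖w - u‖) (𝓝 u) (𝓝 0) := by
    have : Continuous fun w => L * ‖w - u‖ := by fun_prop
    simpa using this.tendsto u
  refine squeeze_zero' (Eventually.of_forall fun _ => norm_nonneg _) ?_ h₁
  have h₂ : ∀ᶠ w in 𝓝 u, ‖w‖ < ‖u‖ + 1 := continuous_norm.continuousAt.eventually_lt
    continuousAt_const (by simp)
  filter_upwards [h₂] with w hw
  exact hL w u hw.le (by simp)

theorem continuous_force : Continuous (P.force : H (k + 1) → H (k + 1)) :=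
  continuous_of_bounded_lipschitz fun B => by
    obtain ⟨L, _, hL⟩ := P.exists_norm_force_sub_le (k := k) B
    exact ⟨L, hL⟩

theorem continuous_density : Continuous (P.density : H (k + 1) → H (k + 1)) :=
  continuous_of_bounded_lipschitz fun B => by
    obtain ⟨C, hC⟩ := P.exists_isMulBounded_norm (k := k)
    exact ⟨_, hC.density_sub_le B⟩

@[simp]
theorem force_zero : P.force (0 : H (k + 1)) = 0 := by
  simp [force, nonlin]

/-- `K` depends only on the norm one order below, although `force` is cubic: tame product estimates
are applied first to the density and then to its product with `u`. -/
theorem exists_norm_force_le_tame (B : ℝ) : ∃ K : ℝ, 0 ≤ K ∧ ∀ u : H (k + 2), ‖H.incl u‖ ≤ B →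
    ‖P.force u‖ ≤ K * ‖u‖ := by
  obtain ⟨C, hC, hmul⟩ := H.exists_norm_mul_le_tame k
  obtain ⟨D, hD, hD'⟩ := exists_norm_density_le (P := P) (k := k) B
  set q := ‖H.plane (k := k + 2) P.κ‖
  set q' := ‖H.plane (k := k + 2) (-P.κ)‖
  set A := 2 * C * B + ‖P.R‖ * q + ‖P.R‖ * q' with hA
  set K := ‖(-(P.α / 2) + Complex.I * P.c : ℂ)‖ +
    ‖(P.g : ℂ)‖ * (C * (A * B + D * B) + ‖P.R‖ * (q * A)) with hK
  refine ⟨|K|, abs_nonneg _, fun u hu => ?_⟩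
  have hu0 := norm_nonneg u
  have hB : 0 ≤ B := (norm_nonneg _).trans hu
  have e : H.incl (conjH u) = conjH (H.incl u) := rfl
  have hρ : ‖P.density u‖ ≤ A * ‖u‖ := by
    have h₁ : ‖H.mul u (conjH u)‖ ≤ C * (2 * B * ‖u‖) := by
      refine (hmul _ _).trans ?_
      rw [e, norm_conjH, norm_conjH]
      gcongr
      nlinarith
    have h₂ : ‖P.R • H.plane P.κ (conjH u)‖ ≤ ‖P.R‖ * (q * ‖u‖) := by
      rw [norm_smul]
      gcongr
      exact ((H.plane P.κ).le_opNorm _).trans (by rw [norm_conjH])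
    have h₃ : ‖(starRingEnd ℂ P.R) • H.plane (-P.κ) u‖ ≤ ‖P.R‖ * (q' * ‖u‖) := by
      rw [norm_smul, RCLike.norm_conj]
      gcongr
      exact (H.plane (-P.κ)).le_opNorm _
    refine (norm_add₃_le).trans ?_
    rw [hA]
    linarith
  have hρ' : ‖H.incl (P.density u)‖ ≤ D * B := by
    rw [incl_density]
    exact (hD' _ hu).trans (by gcongr)
  have h₁ : ‖H.mul (P.density u) u‖ ≤ C * (A * B + D * B) * ‖u‖ := by
    refine (hmul _ _).trans ?_
    have h₁ : ‖P.density u‖ * ‖H.incl u‖ ≤ A * ‖u‖ * B := by gcongr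
    have h₂ : ‖H.incl (P.density u)‖ * ‖u‖ ≤ D * B * ‖u‖ := by gcongr
    have h₃ := mul_le_mul_of_nonneg_left (add_le_add h₁ h₂) hC
    linarith
  have h₂ : ‖P.R • H.plane P.κ (P.density u)‖ ≤ ‖P.R‖ * (q * A) * ‖u‖ := by
    rw [norm_smul, mul_assoc, mul_assoc]
    gcongr
    exact ((H.plane P.κ).le_opNorm _).trans (by gcongr)
  have h₃ : ‖P.force u‖ ≤ K * ‖u‖ := by
    refine (norm_sub_le _ _).trans ?_
    rw [nonlin, norm_smul, norm_smul, norm_smul, Complex.norm_I, one_mul, hK, add_mul,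
      mul_assoc ‖(P.g : ℂ)‖]
    gcongr
    refine (norm_add_le _ _).trans ?_
    linarith
  exact h₃.trans (by gcongr; exact le_abs_self _)

end Params

/-! ### Abstract differential equations: an a priori bound gives global existence. -/

section ODE

variable {E : Type*} [NormedAddCommGroup E]

/-- A Lipschitz cutoff, equal to `1` on the ball of radius `r` and to `0` outside the ball of
radius `r + 1`. -/
def cutoff (r : ℝ) (x : E) : ℝ := max 0 (min 1 (r + 1 - ‖x‖))

theorem cutoff_nonneg (r : ℝ) (x : E) : 0 ≤ cutoff r x := le_max_left _ _

theorem cutoff_le_one (r : ℝ) (x : E) : cutoff r x ≤ 1 := max_le zero_le_one (min_le_left _ _)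

theorem cutoff_of_le {r : ℝ} {x : E} (h : ‖x‖ ≤ r) : cutoff r x = 1 := by
  rw [cutoff, min_eq_left (by linarith), max_eq_right zero_le_one]

theorem cutoff_of_ge {r : ℝ} {x : E} (h : r + 1 ≤ ‖x‖) : cutoff r x = 0 := by
  rw [cutoff, max_eq_left ((min_le_right _ _).trans (by linarith))]

theorem abs_cutoff_sub_le (r : ℝ) (x y : E) : |cutoff r x - cutoff r y| ≤ ‖x - y‖ := by
  refine (abs_max_sub_max_le_max _ _ _ _).trans (max_le (by simp) ?_)
  refine (abs_min_sub_min_le_max _ _ _ _).trans (max_le (by simp) ?_)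
  rw [sub_sub_sub_cancel_left, norm_sub_rev]
  exact abs_norm_sub_norm_le y x

variable [NormedSpace ℝ E]

/-- `v` solves `v' = F(t, v)` on `[0, T]`, with the derivative taken from the right. -/
structure IsForwardSolution (F : ℝ → E → E) (T : ℝ) (v : ℝ → E) : Prop where
  continuousOn : ContinuousOn v (Icc 0 T)
  hasDerivWithinAt : ∀ t ∈ Ico 0 T, HasDerivWithinAt v (F t (v t)) (Ici t) t

theorem IsForwardSolution.mono {F : ℝ → E → E} {S T : ℝ} {v : ℝ → E}
    (h : IsForwardSolution F T v) (hST : S ≤ T) : IsForwardSolution F S v :=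
  ⟨h.continuousOn.mono (Icc_subset_Icc_right hST),
    fun t ht => h.hasDerivWithinAt t ⟨ht.1, ht.2.trans_le hST⟩⟩

theorem isForwardSolution_of_Icc {F : ℝ → E → E} {T : ℝ} {v : ℝ → E}
    (h : ∀ t ∈ Icc 0 T, HasDerivWithinAt v (F t (v t)) (Icc 0 T) t) : IsForwardSolution F T v :=
  ⟨fun t ht => (h t ht).continuousWithinAt, fun t ht =>
    (h t (Ico_subset_Icc_self ht)).mono_of_mem_nhdsWithin (mem_of_superset
      (Icc_mem_nhdsGE ht.2) (Icc_subset_Icc_left ht.1))⟩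

theorem IsForwardSolution.eqOn {F : ℝ → E → E}
    (hL : ∀ B : ℝ, ∃ L : ℝ, 0 ≤ L ∧ ∀ t x y, ‖x‖ ≤ B → ‖y‖ ≤ B → ‖F t x - F t y‖ ≤ L * ‖x - y‖)
    {T : ℝ} {v w : ℝ → E} (hv : IsForwardSolution F T v) (hw : IsForwardSolution F T w)
    (h0 : v 0 = w 0) : EqOn v w (Icc 0 T) := by
  obtain ⟨B₁, hB₁⟩ := isCompact_Icc.exists_bound_of_continuousOn hv.continuousOn
  obtain ⟨B₂, hB₂⟩ := isCompact_Icc.exists_bound_of_continuousOn hw.continuousOn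
  obtain ⟨L, hL0, hL⟩ := hL (max B₁ B₂)
  refine ODE_solution_unique_of_mem_Icc_right (v := F) (K := ⟨L, hL0⟩)
    (s := fun _ => {x | ‖x‖ ≤ max B₁ B₂}) ?_ hv.continuousOn hv.hasDerivWithinAt ?_
    hw.continuousOn hw.hasDerivWithinAt ?_ h0
  · intro t _
    exact LipschitzOnWith.of_dist_le_mul fun x hx y hy => by
      rw [dist_eq_norm, dist_eq_norm]
      exact hL t x y hx hy
  · exact fun t ht => (hB₁ t (Ico_subset_Icc_self ht)).trans (le_max_left _ _)
  · exact fun t ht => (hB₂ t (Ico_subset_Icc_self ht)).trans (le_max_right _ _)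

theorem norm_cutoff_smul_le {f : E → E} {r L : ℝ} (hr : 0 ≤ r) (hL : 0 ≤ L)
    (h : ∀ x y, ‖x‖ ≤ r + 1 → ‖y‖ ≤ r + 1 → ‖f x - f y‖ ≤ L * ‖x - y‖) (h0 : f 0 = 0) (x : E) :
    ‖cutoff r x • f x‖ ≤ L * (r + 1) := by
  rcases le_total ‖x‖ (r + 1) with hx | hx
  · have := h x 0 hx (by rw [norm_zero]; linarith)
    rw [h0, sub_zero, sub_zero] at this
    rw [norm_smul, Real.norm_of_nonneg (cutoff_nonneg r x)]
    calc _ ≤ 1 * (L * ‖x‖) :=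
          mul_le_mul (cutoff_le_one r x) this (norm_nonneg _) zero_le_one
      _ ≤ _ := by rw [one_mul]; gcongr
  · rw [cutoff_of_ge hx, zero_smul, norm_zero]
    positivity

/-- Truncation turns a field that is Lipschitz on a ball into a globally Lipschitz one. `L` comes
from `f`; `L * (r + 1)` is the supremum of `‖f‖` on the ball times the Lipschitz constant `1` of the
cutoff. -/
theorem norm_cutoff_smul_sub_le {f : E → E} {r L : ℝ} (hr : 0 ≤ r) (hL : 0 ≤ L)
    (h : ∀ x y, ‖x‖ ≤ r + 1 → ‖y‖ ≤ r + 1 → ‖f x - f y‖ ≤ L * ‖x - y‖) (h0 : f 0 = 0) (x y : E) :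
    ‖cutoff r x • f x - cutoff r y • f y‖ ≤ (L + L * (r + 1)) * ‖x - y‖ := by
  have hf : ∀ x, ‖x‖ ≤ r + 1 → ‖f x‖ ≤ L * (r + 1) := by
    intro x hx
    have := h x 0 hx (by rw [norm_zero]; linarith)
    rw [h0, sub_zero, sub_zero] at this
    exact this.trans (by gcongr)
  have key : ∀ x y, ‖x‖ ≤ r + 1 →
      ‖cutoff r x • f x - cutoff r y • f y‖ ≤ (L + L * (r + 1)) * ‖x - y‖ := by
    intro x y hx
    have h₁ : ‖(cutoff r x - cutoff r y) • f x‖ ≤ L * (r + 1) * ‖x - y‖ := by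
      rw [norm_smul, mul_comm]
      exact mul_le_mul (hf x hx) (abs_cutoff_sub_le r x y) (norm_nonneg _) (by positivity)
    rcases le_total ‖y‖ (r + 1) with hy | hy
    · have e : cutoff r x • f x - cutoff r y • f y =
          cutoff r y • (f x - f y) + (cutoff r x - cutoff r y) • f x := by
        rw [smul_sub, sub_smul]; abel
      have h₂ : ‖cutoff r y • (f x - f y)‖ ≤ L * ‖x - y‖ := by
        rw [norm_smul, Real.norm_of_nonneg (cutoff_nonneg r y)]
        calc _ ≤ 1 * (L * ‖x - y‖) :=
              mul_le_mul (cutoff_le_one r y) (h x y hx hy) (norm_nonneg _) zero_le_one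
          _ = _ := one_mul _
      rw [e, add_mul]
      exact (norm_add_le _ _).trans (add_le_add h₂ h₁)
    · rw [cutoff_of_ge hy, sub_zero] at h₁
      rw [cutoff_of_ge hy, zero_smul, sub_zero, add_mul]
      exact h₁.trans (le_add_of_nonneg_left (by positivity))
  rcases le_total ‖x‖ (r + 1) with hx | hx
  · exact key x y hx
  · rcases le_total ‖y‖ (r + 1) with hy | hy
    · rw [norm_sub_rev, norm_sub_rev x]
      exact key y x hy
    · rw [cutoff_of_ge hx, cutoff_of_ge hy, zero_smul, zero_smul, sub_zero, norm_zero]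
      positivity

variable [CompleteSpace E] {F : ℝ → E → E}

/-- Solve the equation truncated at radius `B + 1` on all of `[0, T]`, then show by continuity that
the solution never leaves the ball of radius `B`, where the cutoff equals `1`. -/
theorem exists_solution_Icc (hc : ∀ x, Continuous fun t => F t x)
    (hL : ∀ B : ℝ, ∃ L : ℝ, 0 ≤ L ∧ ∀ t x y, ‖x‖ ≤ B → ‖y‖ ≤ B → ‖F t x - F t y‖ ≤ L * ‖x - y‖)
    (h0 : ∀ t, F t 0 = 0) (x₀ : E) {T B : ℝ} (hT : 0 ≤ T) (hx₀ : ‖x₀‖ ≤ B)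
    (hap : ∀ t ≤ T, ∀ v, IsForwardSolution F t v → v 0 = x₀ → ∀ s ∈ Icc 0 t, ‖v s‖ ≤ B) :
    ∃ v : ℝ → E, v 0 = x₀ ∧ ∀ t ∈ Icc 0 T, HasDerivWithinAt v (F t (v t)) (Icc 0 T) t := by
  have hB : 0 ≤ B := (norm_nonneg _).trans hx₀
  have hr : 0 ≤ B + 1 := by linarith
  obtain ⟨L, hL0, hL⟩ := hL (B + 1 + 1)
  set G : ℝ → E → E := fun t x => cutoff (B + 1) x • F t x with hG
  have hM : 0 ≤ L * (B + 1 + 1) := by positivity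
  have hK : 0 ≤ L + L * (B + 1 + 1) := by positivity
  -- The truncated field has norm at most `L * (B + 1 + 1)`, so a ball of radius that bound times
  -- `T` cannot be left before time `T`, and one application covers the whole interval.
  have hPL : IsPicardLindelof G (tmin := 0) (tmax := T) ⟨0, left_mem_Icc.2 hT⟩ x₀
      (⟨L * (B + 1 + 1) * T, by positivity⟩) 0 ⟨L * (B + 1 + 1), hM⟩
      ⟨L + L * (B + 1 + 1), hK⟩ := by
    refine ⟨fun t _ => ?_, fun x _ => ?_, fun t _ x _ => ?_, ?_⟩
    · refine LipschitzOnWith.of_dist_le_mul fun x _ y _ => ?_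
      rw [dist_eq_norm, dist_eq_norm]
      exact norm_cutoff_smul_sub_le hr hL0 (hL t) (h0 t) x y
    · exact ((hc x).const_smul _).continuousOn
    · exact norm_cutoff_smul_le hr hL0 (hL t) (h0 t) x
    · simp [hT]
      exact le_rfl
  obtain ⟨v, hv0, hv⟩ := hPL.exists_eq_forall_mem_Icc_hasDerivWithinAt₀
  have hvc : ContinuousOn v (Icc 0 T) := fun t ht => (hv t ht).continuousWithinAt
  have hvG : IsForwardSolution G T v := isForwardSolution_of_Icc hv
  have hbd : Icc 0 T ⊆ {t | ∀ s ∈ Icc 0 t, ‖v s‖ ≤ B} := by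
    have h00 : (0 : ℝ) ∈ {t | ∀ s ∈ Icc 0 t, ‖v s‖ ≤ B} := by
      intro s hs
      rw [Icc_self, mem_singleton_iff] at hs
      rw [hs]
      exact hv0 ▸ hx₀
    refine IsClosed.Icc_subset_of_forall_exists_gt ?_ h00 ?_
    · rw [← isSeqClosed_iff_isClosed]
      intro τ t hτ ht
      have htI : t ∈ Icc 0 T := isClosed_Icc.mem_of_tendsto ht
        (Eventually.of_forall fun n => (hτ n).2)
      refine ⟨fun s hs => ?_, htI⟩
      rcases hs.2.lt_or_eq with hst | rfl
      · obtain ⟨n, hn⟩ := (ht.eventually (lt_mem_nhds hst)).exists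
        exact (hτ n).1 s ⟨hs.1, hn.le⟩
      · have h₁ : Tendsto τ atTop (𝓝[Icc 0 T] s) :=
          tendsto_nhdsWithin_iff.2 ⟨ht, Eventually.of_forall fun n => (hτ n).2⟩
        have h₂ := ((hvc s htI).tendsto.comp h₁).norm
        exact le_of_tendsto h₂ (Eventually.of_forall fun n =>
          (hτ n).1 (τ n) ⟨(hτ n).2.1, le_rfl⟩)
    -- The bound `B` at time `t` is strictly below `B + 1`, so slightly beyond `t` the curve still
    -- solves the untruncated equation. The a priori hypothesis then restores the bound `B` there.
    · rintro t ⟨ht, htI⟩ y hy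
      have hlt : ‖v t‖ < B + 1 := (ht t ⟨htI.1, le_rfl⟩).trans_lt (by linarith)
      have hcont : ContinuousWithinAt v (Ici t) t :=
        (hvG.hasDerivWithinAt t htI).continuousWithinAt
      have hev : ∀ᶠ s in 𝓝[≥] t, ‖v s‖ < B + 1 := hcont.norm.eventually (gt_mem_nhds hlt)
      obtain ⟨z, hz, hzs⟩ := (mem_nhdsGE_iff_exists_Icc_subset).1 hev
      set w := min z (min y T) with hw
      have htw : t < w := lt_min hz (lt_min hy htI.2)
      have hsol : IsForwardSolution F w v := by
        refine ⟨hvc.mono (Icc_subset_Icc_right ((min_le_right _ _).trans (min_le_right _ _))),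
          fun s hs => ?_⟩
        have h₁ := hvG.hasDerivWithinAt s ⟨hs.1, hs.2.trans_le
          ((min_le_right _ _).trans (min_le_right _ _))⟩
        have h₂ : ‖v s‖ ≤ B + 1 := by
          rcases le_total s t with hst | hst
          · exact (ht s ⟨hs.1, hst⟩).trans (by linarith)
          · exact (hzs ⟨hst, hs.2.le.trans (min_le_left _ _)⟩ : ‖v s‖ < B + 1).le
        rw [hG] at h₁
        simp only [cutoff_of_le h₂, one_smul] at h₁
        exact h₁
      exact ⟨w, hap w ((min_le_right _ _).trans (min_le_right _ _)) v hsol hv0, htw,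
        (min_le_right _ _).trans (min_le_left _ _)⟩
  refine ⟨v, hv0, fun t ht => ?_⟩
  have h₁ := hv t ht
  have h₂ : ‖v t‖ ≤ B + 1 := (hbd ht t ⟨ht.1, le_rfl⟩).trans (by linarith)
  rw [hG] at h₁
  simp only [cutoff_of_le h₂, one_smul] at h₁
  exact h₁

theorem exists_global_solution (hc : ∀ x, Continuous fun t => F t x)
    (hL : ∀ B : ℝ, ∃ L : ℝ, 0 ≤ L ∧ ∀ t x y, ‖x‖ ≤ B → ‖y‖ ≤ B → ‖F t x - F t y‖ ≤ L * ‖x - y‖)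
    (h0 : ∀ t, F t 0 = 0) (x₀ : E)
    (hap : ∀ T : ℝ, 0 ≤ T → ∃ B : ℝ, ∀ t ≤ T, ∀ v, IsForwardSolution F t v → v 0 = x₀ →
      ∀ s ∈ Icc 0 t, ‖v s‖ ≤ B) :
    ∃ v : ℝ → E, v 0 = x₀ ∧ ∀ t, 0 ≤ t → HasDerivWithinAt v (F t (v t)) (Ici 0) t := by
  have hn : ∀ n : ℕ, ∃ v : ℝ → E, v 0 = x₀ ∧
      ∀ t ∈ Icc 0 (n : ℝ), HasDerivWithinAt v (F t (v t)) (Icc 0 (n : ℝ)) t := by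
    intro n
    obtain ⟨B, hB⟩ := hap n n.cast_nonneg
    exact exists_solution_Icc hc hL h0 x₀ (B := max B ‖x₀‖) n.cast_nonneg (le_max_right _ _)
      fun t ht v hv hv0 s hs => (hB t ht v hv hv0 s hs).trans (le_max_left _ _)
  choose v hv0 hv using hn
  have hsol : ∀ n : ℕ, IsForwardSolution F n (v n) := fun n => isForwardSolution_of_Icc (hv n)
  -- The `+ 1` puts `t` strictly below the right endpoint of the chosen interval, so the derivative
  -- within that interval is a derivative within `[0, ∞)`.
  have hglue : ∀ n : ℕ, EqOn (fun t => v (⌈t⌉₊ + 1) t) (v n) (Icc 0 (n : ℝ)) := by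
    intro n t ht
    have h₁ : t ≤ (⌈t⌉₊ + 1 : ℕ) := by
      push_cast
      exact (Nat.le_ceil t).trans (by linarith)
    exact IsForwardSolution.eqOn hL (T := t) ((hsol (⌈t⌉₊ + 1)).mono h₁) ((hsol n).mono ht.2)
      ((hv0 _).trans (hv0 n).symm) ⟨ht.1, le_rfl⟩
  refine ⟨fun t => v (⌈t⌉₊ + 1) t, hv0 _, fun t ht => ?_⟩
  have h₁ : t < (⌈t⌉₊ + 1 : ℕ) := by
    push_cast
    exact (Nat.le_ceil t).trans_lt (by linarith)
  have h₂ := (hv (⌈t⌉₊ + 1) t ⟨ht, h₁.le⟩).congr_of_mem (hglue _) ⟨ht, h₁.le⟩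
  exact h₂.mono_of_mem_nhdsWithin (by
    have : Icc 0 ((⌈t⌉₊ + 1 : ℕ) : ℝ) = Ici 0 ∩ Iic ((⌈t⌉₊ + 1 : ℕ) : ℝ) := rfl
    rw [this]
    exact inter_mem self_mem_nhdsWithin (mem_nhdsWithin_of_mem_nhds (Iic_mem_nhds h₁)))

end ODE

/-! ### Weak solutions in `H^1` and the chain rule along them. -/

theorem inner_schwartz_deriv (ψ : 𝓢(ℝ, ℂ)) {f f' : L2} (h : HasWeakDeriv f f') :
    inner ℂ (schwartzL2 (SchwartzMap.derivCLM ℂ ℂ ψ)) f = -inner ℂ (schwartzL2 ψ) f' := by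
  rw [integral_schwartz_mul_eq_inner, integral_schwartz_mul_eq_inner]
  have := hasWeakDeriv_iff.1 h (conjSchwartz ψ)
  simp only [deriv_conjSchwartz, conjSchwartz_apply] at this
  simp only [SchwartzMap.derivCLM_apply]
  simpa only [mul_comm] using this

/-- The pairing of `i∂²f + A` with `m ∈ H^1`, where `f' = f₁` weakly. -/
def weakForm (f₁ A : L2) (m : H 1) : ℂ := -(Complex.I * inner ℂ (m.1 1) f₁) + inner ℂ (m.1 0) A

theorem norm_weakForm_le (f₁ A : L2) (m : H 1) : ‖weakForm f₁ A m‖ ≤ (‖f₁‖ + ‖A‖) * ‖m‖ := by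
  have h₁ : ‖inner ℂ (m.1 1) f₁‖ ≤ ‖m‖ * ‖f₁‖ :=
    (norm_inner_le_norm _ _).trans (by gcongr; exact H.norm_comp_le m 1)
  have h₂ : ‖inner ℂ (m.1 0) A‖ ≤ ‖m‖ * ‖A‖ :=
    (norm_inner_le_norm _ _).trans (by gcongr; exact H.norm_comp_le m 0)
  refine (norm_add_le _ _).trans ?_
  rw [norm_neg, norm_mul, Complex.norm_I, one_mul]
  linarith

theorem weakForm_sub (f₁ A : L2) (m m' : H 1) :
    weakForm f₁ A (m - m') = weakForm f₁ A m - weakForm f₁ A m' := by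
  have e₀ : (m - m').1 0 = m.1 0 - m'.1 0 := rfl
  have e₁ : (m - m').1 1 = m.1 1 - m'.1 1 := rfl
  simp only [weakForm, e₀, e₁, inner_sub_left]
  ring

/-- `φ` solves `φ_t = iφ_ξξ + A` on `[0, T]` in the sense of distributions, with the time
derivative taken from the right. -/
structure IsWeakSolution (A : ℝ → L2) (T : ℝ) (φ : ℝ → H 1) : Prop where
  continuousOn : ContinuousOn φ (Icc 0 T)
  continuousOn_force : ContinuousOn A (Icc 0 T)
  hasDerivWithinAt : ∀ ψ : 𝓢(ℝ, ℂ), ∀ t ∈ Ico 0 T,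
    HasDerivWithinAt (fun s => inner ℂ (schwartzL2 ψ) ((φ s).1 0))
      (weakForm ((φ t).1 1) (A t) (schwartzH1 ψ)) (Ici t) t

theorem IsWeakSolution.sub {A A' : ℝ → L2} {T : ℝ} {φ φ' : ℝ → H 1} (h : IsWeakSolution A T φ)
    (h' : IsWeakSolution A' T φ') :
    IsWeakSolution (fun t => A t - A' t) T (fun t => φ t - φ' t) := by
  refine ⟨h.continuousOn.sub h'.continuousOn, h.continuousOn_force.sub h'.continuousOn_force,
    fun ψ t ht => ?_⟩
  have := (h.hasDerivWithinAt ψ t ht).sub (h'.hasDerivWithinAt ψ t ht)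
  convert! this using 1
  · funext s
    exact inner_sub_right _ _ _
  · have e₁ : (φ t - φ' t).1 1 = (φ t).1 1 - (φ' t).1 1 := rfl
    simp only [weakForm, e₁, inner_sub_right]
    ring

/-- A weak solution is Lipschitz in time with values in the dual of `H^1`: the mean value inequality
gives this for Schwartz `m`, with a constant linear in `‖m‖`, and density extends it to `H^1`. -/
theorem IsWeakSolution.exists_norm_inner_sub_le {A : ℝ → L2} {T : ℝ} {φ : ℝ → H 1}
    (h : IsWeakSolution A T φ) : ∃ K : ℝ, 0 ≤ K ∧ ∀ m : H 1, ∀ t s, 0 ≤ t → t ≤ s → s ≤ T →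
      ‖inner ℂ (m.1 0) ((φ s - φ t).1 0)‖ ≤ K * ‖m‖ * (s - t) := by
  obtain ⟨B₁, hB₁⟩ := isCompact_Icc.exists_bound_of_continuousOn h.continuousOn
  obtain ⟨B₂, hB₂⟩ := isCompact_Icc.exists_bound_of_continuousOn h.continuousOn_force
  refine ⟨|B₁| + |B₂|, by positivity, fun m t s ht hts hs => ?_⟩
  have hc : IsClosed {m : H 1 | ‖inner ℂ (H.comp 0 m) ((φ s - φ t).1 0)‖ ≤
      (|B₁| + |B₂|) * ‖m‖ * (s - t)} := isClosed_le (by fun_prop) (by fun_prop)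
  refine denseRange_schwartzH1.induction_on m hc fun ψ => ?_
  have e : (φ s - φ t).1 0 = (φ s).1 0 - (φ t).1 0 := rfl
  simp only [schwartzH1_zero, e, inner_sub_right]
  have hcont : ContinuousOn (fun s => inner ℂ (schwartzL2 ψ) ((φ s).1 0)) (Icc t s) := by
    have h₁ : Continuous fun u : H 1 => inner ℂ (schwartzL2 ψ) (H.comp 0 u) := by fun_prop
    exact h₁.comp_continuousOn (h.continuousOn.mono (Icc_subset_Icc ht hs))
  refine norm_image_sub_le_of_norm_deriv_right_le_segment hcont
    (fun x hx => h.hasDerivWithinAt ψ x ⟨ht.trans hx.1, hx.2.trans_le hs⟩) (fun x hx => ?_) s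
    ⟨hts, le_rfl⟩
  refine (norm_weakForm_le _ _ _).trans ?_
  have hx' : x ∈ Icc 0 T := ⟨ht.trans hx.1, hx.2.le.trans hs⟩
  gcongr
  · exact (H.norm_comp_le _ _).trans ((hB₁ x hx').trans (le_abs_self _))
  · exact (hB₂ x hx').trans (le_abs_self _)

/-- Extends the weak equation from a fixed Schwartz test function to `H^1` test functions that move
with `s`. The dual Lipschitz bound makes the replacement of `M s` by one Schwartz `ψ` harmless,
uniformly in `s`. -/
theorem IsWeakSolution.tendsto_inner {A : ℝ → L2} {T : ℝ} {φ : ℝ → H 1}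
    (h : IsWeakSolution A T φ) {t : ℝ} (ht : t ∈ Ico 0 T) {M : ℝ → H 1} {M₀ : H 1}
    (hM : Tendsto M (𝓝[>] t) (𝓝 M₀)) :
    Tendsto (fun s => ((s - t)⁻¹ : ℝ) • inner ℂ ((M s).1 0) ((φ s - φ t).1 0)) (𝓝[>] t)
      (𝓝 (weakForm ((φ t).1 1) (A t) M₀)) := by
  obtain ⟨K, hK, hb⟩ := h.exists_norm_inner_sub_le
  set C := ‖(φ t).1 1‖ + ‖A t‖
  rw [Metric.tendsto_nhds]
  intro ε hε
  have hδ : 0 < ε / (3 * (K + C + 1)) := by positivity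
  -- The two replacement errors are at most `2Kδ` and `Cδ`, together below `2ε/3`; the difference
  -- quotient against `ψ` contributes the last `ε/3`.
  set δ := ε / (3 * (K + C + 1)) with hδdef
  obtain ⟨ψ, hψ⟩ := denseRange_schwartzH1.exists_dist_lt M₀ hδ
  have h₁ : ∀ᶠ s in 𝓝[>] t, dist (M s) M₀ < δ := Metric.tendsto_nhds.1 hM δ hδ
  have h₂ : ∀ᶠ s in 𝓝[>] t, ‖(s - t)⁻¹ • inner ℂ (schwartzL2 ψ) ((φ s - φ t).1 0) -
      weakForm ((φ t).1 1) (A t) (schwartzH1 ψ)‖ < ε / 3 := by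
    have h₃ := (hasDerivWithinAt_iff_tendsto_slope' self_notMem_Ioi).1
      ((h.hasDerivWithinAt ψ t ht).mono Ioi_subset_Ici_self)
    have h₄ := Metric.tendsto_nhds.1 h₃ (ε / 3) (by positivity)
    filter_upwards [h₄] with s hs
    rw [dist_eq_norm, slope_def_module, ← inner_sub_right] at hs
    exact hs
  have h₅ : ∀ᶠ s in 𝓝[>] t, s ∈ Ioc t T := Ioc_mem_nhdsGT ht.2
  filter_upwards [h₁, h₂, h₅] with s hs₁ hs₂ hs₃
  rw [dist_eq_norm] at hs₁ hψ ⊢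
  have hst : 0 < s - t := sub_pos.2 hs₃.1
  have e : ((s - t)⁻¹ : ℝ) • inner ℂ ((M s).1 0) ((φ s - φ t).1 0) -
      weakForm ((φ t).1 1) (A t) M₀ =
      ((s - t)⁻¹ : ℝ) • inner ℂ ((M s - schwartzH1 ψ).1 0) ((φ s - φ t).1 0) +
      (((s - t)⁻¹ : ℝ) • inner ℂ (schwartzL2 ψ) ((φ s - φ t).1 0) -
      weakForm ((φ t).1 1) (A t) (schwartzH1 ψ)) -
      weakForm ((φ t).1 1) (A t) (M₀ - schwartzH1 ψ) := by
    have e₁ : (M s - schwartzH1 ψ).1 0 = (M s).1 0 - schwartzL2 ψ := rfl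
    rw [weakForm_sub, e₁, inner_sub_left, smul_sub]
    ring
  have n₁ : ‖((s - t)⁻¹ : ℝ) • inner ℂ ((M s - schwartzH1 ψ).1 0) ((φ s - φ t).1 0)‖ ≤
      K * (2 * δ) := by
    rw [norm_smul, Real.norm_of_nonneg (by positivity), inv_mul_le_iff₀ hst]
    refine (hb (M s - schwartzH1 ψ) t s ht.1 hs₃.1.le hs₃.2).trans ?_
    rw [mul_comm (s - t)]
    have : ‖M s - schwartzH1 ψ‖ ≤ 2 * δ := by
      have := norm_sub_le_norm_sub_add_norm_sub (M s) M₀ (schwartzH1 ψ)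
      linarith
    gcongr
  have n₂ : ‖weakForm ((φ t).1 1) (A t) (M₀ - schwartzH1 ψ)‖ ≤ C * δ :=
    (norm_weakForm_le _ _ _).trans (mul_le_mul_of_nonneg_left hψ.le (by positivity))
  have n₃ : K * (2 * δ) + C * δ < 2 * ε / 3 := by
    have hC : 0 ≤ C := by positivity
    have hC' : 3 * (K + C + 1) ≠ 0 := by positivity
    have : 3 * (K + C + 1) * δ = ε := mul_div_cancel₀ _ hC'
    nlinarith [mul_nonneg hC hδ.le]
  rw [e]
  calc _ ≤ K * (2 * δ) + ‖((s - t)⁻¹ : ℝ) • inner ℂ (schwartzL2 ψ) ((φ s - φ t).1 0) -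
      weakForm ((φ t).1 1) (A t) (schwartzH1 ψ)‖ + C * δ :=
        (norm_sub_le _ _).trans (add_le_add ((norm_add_le _ _).trans (add_le_add n₁ le_rfl)) n₂)
    _ < ε := by linarith

/-- Chain rule along a weak solution for a functional whose increments are given by an
`H^1`-valued gradient. -/
theorem IsWeakSolution.hasDerivWithinAt_of_sub_eq {A : ℝ → L2} {T : ℝ} {φ : ℝ → H 1}
    (h : IsWeakSolution A T φ) {t : ℝ} (ht : t ∈ Ico 0 T) {M : ℝ → H 1} {M₀ : H 1}
    (hM : Tendsto M (𝓝[>] t) (𝓝 M₀)) {J : ℝ → ℝ}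
    (hJ : ∀ s, J s - J t = (inner ℂ ((M s).1 0) ((φ s - φ t).1 0)).re) :
    HasDerivWithinAt J (weakForm ((φ t).1 1) (A t) M₀).re (Ici t) t := by
  rw [← hasDerivWithinAt_Ioi_iff_Ici, hasDerivWithinAt_iff_tendsto_slope' self_notMem_Ioi]
  have h₁ := (Complex.continuous_re.tendsto _).comp (h.tendsto_inner ht hM)
  refine h₁.congr fun s => ?_
  rw [slope_def_module, hJ]
  exact Complex.smul_re _ _

theorem norm_sq_sub_norm_sq_L2 (f g : L2) :
    ‖f‖ ^ 2 - ‖g‖ ^ 2 = (inner ℂ (f + g) (f - g)).re := by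
  have e₁ : inner ℂ f f = ((‖f‖ ^ 2 : ℝ) : ℂ) := by
    rw [inner_self_eq_norm_sq_to_K]; norm_cast
  have e₂ : inner ℂ g g = ((‖g‖ ^ 2 : ℝ) : ℂ) := by
    rw [inner_self_eq_norm_sq_to_K]; norm_cast
  have e₃ : (inner ℂ f g).re = (inner ℂ g f).re := by
    rw [← inner_conj_symm, Complex.conj_re]
  rw [inner_add_left, inner_sub_right, inner_sub_right, e₁, e₂]
  simp only [Complex.add_re, Complex.sub_re, Complex.ofReal_re, e₃]
  ring

theorem IsWeakSolution.tendsto_nhdsGT {A : ℝ → L2} {T : ℝ} {φ : ℝ → H 1}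
    (h : IsWeakSolution A T φ) {t : ℝ} (ht : t ∈ Ico 0 T) : Tendsto φ (𝓝[>] t) (𝓝 (φ t)) := by
  have h₁ := h.continuousOn t (Ico_subset_Icc_self ht)
  refine h₁.tendsto.mono_left (nhdsWithin_le_of_mem ?_)
  exact mem_of_superset (Ioc_mem_nhdsGT ht.2) fun s hs => ⟨ht.1.trans hs.1.le, hs.2⟩

/-- The gradient `φ(s) + φ(t)` tends to `2φ(t)`. The dispersive term contributes `-2i‖φ_ξ‖²`, whose
real part vanishes. -/
theorem IsWeakSolution.hasDerivWithinAt_norm_sq {A : ℝ → L2} {T : ℝ} {φ : ℝ → H 1}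
    (h : IsWeakSolution A T φ) {t : ℝ} (ht : t ∈ Ico 0 T) :
    HasDerivWithinAt (fun s => ‖(φ s).1 0‖ ^ 2) (2 * (inner ℂ ((φ t).1 0) (A t)).re) (Ici t) t := by
  have h₁ := h.hasDerivWithinAt_of_sub_eq ht ((h.tendsto_nhdsGT ht).add_const (φ t))
    (J := fun s => ‖(φ s).1 0‖ ^ 2) (fun s => norm_sq_sub_norm_sq_L2 ((φ s).1 0) ((φ t).1 0))
  convert h₁ using 1
  have e₀ : (φ t + φ t).1 0 = (φ t).1 0 + (φ t).1 0 := rfl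
  have e₁ : (φ t + φ t).1 1 = (φ t).1 1 + (φ t).1 1 := rfl
  have e₂ : inner ℂ ((φ t).1 1) ((φ t).1 1) = ((‖(φ t).1 1‖ ^ 2 : ℝ) : ℂ) := by
    rw [inner_self_eq_norm_sq_to_K]; norm_cast
  rw [weakForm, e₀, e₁, inner_add_left, inner_add_left, e₂, ← Complex.ofReal_add]
  simp only [Complex.add_re, Complex.neg_re, Complex.I_mul_re, Complex.ofReal_im]
  ring

theorem le_exp_of_deriv_right_le {J J' : ℝ → ℝ} {K T : ℝ} (hJ : ContinuousOn J (Icc 0 T))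
    (hJ' : ∀ t ∈ Ico 0 T, HasDerivWithinAt J (J' t) (Ici t) t)
    (hb : ∀ t ∈ Ico 0 T, J' t ≤ K * J t) : ∀ t ∈ Icc 0 T, J t ≤ J 0 * Real.exp (K * t) := by
  intro t ht
  have := le_gronwallBound_of_liminf_deriv_right_le hJ
    (fun x hx r hr => (hJ' x hx).liminf_right_slope_le hr) le_rfl
    (ε := 0) (K := K) (fun x hx => by simpa using hb x hx) t ht
  rwa [gronwallBound_ε0, sub_zero] at this

/-! ### Pointwise estimates for the nonlinearity and the increment of `‖ρ‖²`. -/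

namespace Params

variable (P : Params)

theorem g_nonneg (hlam : P.lam < 0) (hω : 0 < P.ω) : 0 ≤ P.g := by
  rw [g, neg_nonneg]
  exact div_nonpos_of_nonpos_of_nonneg (by linarith) (by linarith)

theorem norm_η (x : ℝ) : ‖P.η x‖ = ‖P.R‖ := by rw [η_eq, norm_mul, norm_planeWave, mul_one]

theorem integrable_conj_mul (f g : L2) : Integrable fun x => (starRingEnd ℂ) (f x) * g x := by
  have := L2.integrable_inner (𝕜 := ℂ) f g
  refine this.congr (Eventually.of_forall fun x => ?_)
  simp [mul_comm]

theorem inner_L2_eq (f g : L2) : inner ℂ f g = ∫ x, (starRingEnd ℂ) (f x) * g x := by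
  rw [L2.inner_def]
  congr 1
  funext x
  simp [mul_comm]

theorem inner_L2_re (f g : L2) : (inner ℂ f g).re = ∫ x, ((starRingEnd ℂ) (f x) * g x).re := by
  rw [inner_L2_eq]
  exact (integral_re (integrable_conj_mul f g)).symm

theorem inner_L2_im (f g : L2) : (inner ℂ f g).im = ∫ x, ((starRingEnd ℂ) (f x) * g x).im := by
  rw [inner_L2_eq]
  exact (integral_im (integrable_conj_mul f g)).symm

variable {P}

/-- Pointwise, with `z = u` and `e = η`, the integrand is `(g/2)(ρ² + ρ|z|²)` and `ρ ≥ -|e|²`. Only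
a quadratic loss remains, because `g ≥ 0`. -/
theorem re_inner_nonlin_ge (hg : 0 ≤ P.g) (u : H (k + 1)) :
    -(P.g / 2 * ‖P.R‖ ^ 2 * ‖u.1 0‖ ^ 2) ≤ (inner ℂ ((P.nonlin u).1 0) (u.1 0)).re := by
  rw [inner_L2_re, norm_sq_L2, ← integral_const_mul, ← integral_neg]
  refine integral_mono_ae ((integrable_norm_sq_L2 _).const_mul _).neg
    (integrable_conj_mul _ _).re ?_
  filter_upwards [P.coeFn_nonlin u] with x hx
  rw [hx, N, H.fn, ← norm_η P x, show -(3 * P.lam / (2 * P.ω)) = P.g from rfl]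
  rw [map_mul, Complex.conj_ofReal, mul_assoc _ ((starRingEnd ℂ) _), Complex.re_ofReal_mul]
  set z := u.1 0 x
  set e := P.η x
  have h₁ : ((starRingEnd ℂ) (z + e) * z).re = (‖z‖ ^ 2 + (‖z + e‖ ^ 2 - ‖e‖ ^ 2)) / 2 := by
    simp only [Complex.sq_norm, Complex.normSq_apply, map_add, Complex.mul_re, Complex.add_re,
      Complex.add_im, Complex.conj_re, Complex.conj_im]
    ring
  rw [h₁]
  have h₂ : 0 ≤ P.g / 2 * ((‖z + e‖ ^ 2 - ‖e‖ ^ 2) ^ 2 + ‖z‖ ^ 2 * ‖z + e‖ ^ 2) := by positivity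
  linarith

/-- In `Im(conj(z + e)z)` the part `|z|²` is real and drops out, leaving `Im(ēz)`. The bound is thus
quadratic in `(ρ, z)`, within reach of the modified energy. -/
theorem abs_im_inner_nonlin_le (hg : 0 ≤ P.g) (u : H (k + 1)) :
    |(inner ℂ ((P.nonlin u).1 0) (u.1 0)).im| ≤
      P.g * ‖P.R‖ / 2 * (‖(P.density u).1 0‖ ^ 2 + ‖u.1 0‖ ^ 2) := by
  rw [inner_L2_im, norm_sq_L2, norm_sq_L2, ← integral_add (integrable_norm_sq_L2 _)
    (integrable_norm_sq_L2 _), ← integral_const_mul]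
  refine (abs_integral_le_integral_abs).trans ?_
  refine integral_mono_ae (integrable_conj_mul _ _).im.abs
    (((integrable_norm_sq_L2 _).add (integrable_norm_sq_L2 _)).const_mul _) ?_
  filter_upwards [P.coeFn_nonlin u, P.coeFn_density u] with x hx hx'
  rw [hx, hx', N, H.fn, ← norm_η P x, show -(3 * P.lam / (2 * P.ω)) = P.g from rfl]
  rw [map_mul, Complex.conj_ofReal, mul_assoc, Complex.im_ofReal_mul, Complex.norm_real,
    Real.norm_eq_abs, sq_abs]
  set z := u.1 0 x
  set e := P.η x
  set r := ‖z + e‖ ^ 2 - ‖e‖ ^ 2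
  have h₁ : ((starRingEnd ℂ) (z + e) * z).im = ((starRingEnd ℂ) e * z).im := by
    simp only [map_add, Complex.mul_im, Complex.add_re,
      Complex.add_im, Complex.conj_re, Complex.conj_im]
    ring
  have h₂ : |((starRingEnd ℂ) e * z).im| ≤ ‖e‖ * ‖z‖ := by
    refine (Complex.abs_im_le_norm _).trans ?_
    rw [norm_mul, RCLike.norm_conj]
  rw [h₁, abs_mul, abs_mul, abs_of_nonneg hg]
  calc P.g * |r| * |((starRingEnd ℂ) e * z).im| ≤ P.g * |r| * (‖e‖ * ‖z‖) := by gcongr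
    _ = P.g * ‖e‖ * (|r| * ‖z‖) := by ring
    _ ≤ P.g * ‖e‖ * ((r ^ 2 + ‖z‖ ^ 2) / 2) := by
        gcongr
        nlinarith [sq_nonneg (|r| - ‖z‖), sq_abs r]
    _ = _ := by ring

variable (P)

/-- Factor `ρ_u² - ρ_w² = (ρ_u + ρ_w)(ρ_u - ρ_w)` and use `ρ_u - ρ_w = Re(conj(u + w + 2η)(u - w))`.
This exact increment, with its gradient in `H^1` when `u, w ∈ H^1`, is the form the chain rule
requires. -/
theorem norm_sq_density_sub (u w : H (k + 1)) :
    ‖(P.density u).1 0‖ ^ 2 - ‖(P.density w).1 0‖ ^ 2 =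
      (inner ℂ ((H.mul (P.density u + P.density w) (u + w) +
        (2 * P.R) • H.plane P.κ (P.density u + P.density w)).1 0) ((u - w).1 0)).re := by
  set s := P.density u + P.density w with hs
  rw [inner_L2_re, norm_sq_L2, norm_sq_L2, ← integral_sub (integrable_norm_sq_L2 _)
    (integrable_norm_sq_L2 _)]
  refine integral_congr_ae ?_
  have e₁ : (H.mul s (u + w) + (2 * P.R) • H.plane P.κ s).1 0 =
    (H.mul s (u + w)).1 0 + (2 * P.R) • (H.plane P.κ s).1 0 := rfl
  have e₂ : s.1 0 = (P.density u).1 0 + (P.density w).1 0 := rfl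
  have e₃ : (u + w).1 0 = u.1 0 + w.1 0 := rfl
  have e₄ : (u - w).1 0 = u.1 0 - w.1 0 := rfl
  rw [e₁, e₄]
  filter_upwards [Lp.coeFn_add ((H.mul s (u + w)).1 0) ((2 * P.R) • (H.plane P.κ s).1 0),
    Lp.coeFn_smul (2 * P.R) ((H.plane P.κ s).1 0), H.coeFn_mul s (u + w), H.coeFn_plane P.κ s,
    Lp.coeFn_add ((P.density u).1 0) ((P.density w).1 0), Lp.coeFn_add (u.1 0) (w.1 0),
    Lp.coeFn_sub (u.1 0) (w.1 0), P.coeFn_density u, P.coeFn_density w] with x h₁ h₂ h₃ h₄ h₅ h₆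
    h₇ h₈ h₉
  rw [h₁, Pi.add_apply, h₂, Pi.smul_apply, h₃, h₄, e₂, e₃, h₅, h₆, h₇, Pi.add_apply, Pi.add_apply,
    Pi.sub_apply, h₈, h₉, Complex.norm_real, Complex.norm_real, Real.norm_eq_abs, Real.norm_eq_abs,
    sq_abs, sq_abs, ← Complex.ofReal_add]
  set a := u.1 0 x
  set b := w.1 0 x
  have e₅ : ∀ r : ℝ, (r : ℂ) * (a + b) + (2 * P.R) • (planeWave P.κ x * (r : ℂ)) =
      (r : ℂ) * (a + b + 2 * P.η x) := by
    intro r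
    rw [η_eq, smul_eq_mul]; ring
  rw [e₅, map_mul, Complex.conj_ofReal, mul_assoc, Complex.re_ofReal_mul]
  set e := P.η x
  have e₆ : ((starRingEnd ℂ) (a + b + 2 * e) * (a - b)).re = ‖a + e‖ ^ 2 - ‖b + e‖ ^ 2 := by
    simp only [Complex.sq_norm, Complex.normSq_apply, map_add, map_mul, Complex.mul_re,
      Complex.add_re, Complex.add_im, Complex.conj_re, Complex.conj_im, Complex.sub_re,
      Complex.sub_im, Complex.mul_im, Complex.re_ofNat, Complex.im_ofNat]
    ring
  rw [e₆]
  ring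

end Params

/-! ### From the interaction picture to the distributional equation, and uniqueness. -/

/-- Duhamel's formula in differential form implies the distributional equation. -/
theorem hasDerivWithinAt_inner_freeH {v : ℝ → H (k + 1)} {A : H (k + 1)} {S : Set ℝ} {t : ℝ}
    (h : HasDerivWithinAt v (freeH (-t) A) S t) (ψ : 𝓢(ℝ, ℂ)) :
    HasDerivWithinAt (fun s => inner ℂ (schwartzL2 ψ) ((freeH s (v s)).1 0))
      (weakForm ((freeH t (v t)).1 1) (A.1 0) (schwartzH1 ψ)) S t := by
  have h₁ : HasDerivWithinAt (fun s => (v s).1 0) (freeL2 (-t) (A.1 0)) S t :=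
    ((H.comp (k := k + 1) 0).restrictScalars ℝ).hasFDerivAt.comp_hasDerivWithinAt t h
  have h₂ : HasDerivAt (fun s => freeL2 (-s) (schwartzL2 ψ))
      ((-1 : ℝ) • (Complex.I • freeL2 (-t) (schwartzL2 (SchwartzMap.derivCLM ℂ ℂ
        (SchwartzMap.derivCLM ℂ ℂ ψ))))) t :=
    (hasDerivAt_freeL2 (hasWeakDeriv_schwartz ψ) (hasWeakDeriv_schwartz _) (-t)).scomp t
      (hasDerivAt_neg t)
  have h₃ := h₂.hasDerivWithinAt.inner ℂ h₁
  -- The group is moved onto the Schwartz function, which lies in the domain of `∂²`; `v s` need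
  -- not.
  have e : ∀ s, inner ℂ (schwartzL2 ψ) ((freeH s (v s)).1 0) =
      inner ℂ (freeL2 (-s) (schwartzL2 ψ)) ((v s).1 0) := fun s => by
    rw [freeH_apply, inner_freeL2_right]
  simp only [e]
  refine HasDerivWithinAt.congr_deriv h₃ ?_
  have e₁ : ∀ f g : L2, inner ℂ (freeL2 (-t) f) g = inner ℂ f (freeL2 t g) :=
    fun f g => (inner_freeL2_right t f g).symm
  have hd := H.hasWeakDeriv (freeH t (v t)) 0
  have e₂ := inner_schwartz_deriv (SchwartzMap.derivCLM ℂ ℂ ψ) hd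
  rw [neg_one_smul, inner_neg_left, inner_smul_left, e₁, e₁, freeL2_freeL2, add_neg_cancel,
    freeL2_zero, Complex.conj_I, weakForm, schwartzH1_zero, schwartzH1_one, ← freeH_apply]
  rw [show (freeH t (v t)).1 0 = (freeH t (v t)).1 (Fin.castSucc 0) from rfl, e₂,
    show (freeH t (v t)).1 1 = (freeH t (v t)).1 (Fin.succ 0) from rfl]
  ring

theorem conjSchwartz_conjSchwartz (ψ : 𝓢(ℝ, ℂ)) : conjSchwartz (conjSchwartz ψ) = ψ := by
  ext x
  simp

theorem inner_conjSchwartz (ψ : 𝓢(ℝ, ℂ)) (f : L2) :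
    inner ℂ (schwartzL2 (conjSchwartz ψ)) f = ∫ x, f x * ψ x := by
  simp [integral_schwartz_mul_eq_inner]

theorem inner_conjSchwartz_deriv_deriv (ψ : 𝓢(ℝ, ℂ)) (f : L2) :
    inner ℂ (schwartzL2 (SchwartzMap.derivCLM ℂ ℂ (SchwartzMap.derivCLM ℂ ℂ (conjSchwartz ψ)))) f =
      ∫ x, f x * iteratedDeriv 2 ψ x := by
  have h : SchwartzMap.derivCLM ℂ ℂ (SchwartzMap.derivCLM ℂ ℂ (conjSchwartz ψ)) =
      conjSchwartz (SchwartzMap.derivCLM ℂ ℂ (SchwartzMap.derivCLM ℂ ℂ ψ)) := by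
    have h₁ : ∀ χ, SchwartzMap.derivCLM ℂ ℂ (conjSchwartz χ) =
        conjSchwartz (SchwartzMap.derivCLM ℂ ℂ χ) := fun χ => by
      ext x
      exact deriv_conjSchwartz χ x
    rw [h₁, h₁]
  rw [h, inner_conjSchwartz, iteratedDeriv_succ, iteratedDeriv_one]
  rfl

namespace Params

variable (P : Params)

/-- The equation pairs bilinearly whereas the inner product is conjugate-linear on the left, hence
`conjSchwartz`. The factor `i` belongs to `iφ_τ`. -/
theorem integral_equation_eq (u : H (k + 1)) (ψ : 𝓢(ℝ, ℂ)) :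
    (∫ ξ : ℝ, (-(H.fn u ξ * iteratedDeriv 2 ψ ξ) - Complex.I * P.α / 2 * H.fn u ξ * ψ ξ
        - P.c * H.fn u ξ * ψ ξ + P.N (H.fn u) ξ * ψ ξ)) =
      Complex.I * weakForm (u.1 1) ((P.force u).1 0) (schwartzH1 (conjSchwartz ψ)) := by
  have hI := fun (χ : 𝓢(ℝ, ℂ)) (f : L2) => (integrable_schwartz_mul χ f).congr
    (Eventually.of_forall fun x => mul_comm (χ x) (f x))
  have i₂ : Integrable fun x => u.1 0 x * iteratedDeriv 2 ψ x := by
    have := hI (SchwartzMap.derivCLM ℂ ℂ (SchwartzMap.derivCLM ℂ ℂ ψ)) (u.1 0)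
    rw [iteratedDeriv_succ, iteratedDeriv_one]
    exact this
  have i₀ := hI ψ (u.1 0)
  have iN := hI ψ ((P.nonlin u).1 0)
  have e : ∀ᵐ ξ, (-(H.fn u ξ * iteratedDeriv 2 ψ ξ) - Complex.I * P.α / 2 * H.fn u ξ * ψ ξ
        - P.c * H.fn u ξ * ψ ξ + P.N (H.fn u) ξ * ψ ξ) =
      -(u.1 0 ξ * iteratedDeriv 2 ψ ξ) - (Complex.I * P.α / 2 + P.c) * (u.1 0 ξ * ψ ξ)
        + (P.nonlin u).1 0 ξ * ψ ξ := by
    filter_upwards [P.coeFn_nonlin u] with x hx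
    rw [hx, H.fn]
    ring
  have hF : (P.force u).1 0 =
    (-(P.α / 2) + Complex.I * P.c : ℂ) • u.1 0 - Complex.I • (P.nonlin u).1 0 := rfl
  have hd := inner_schwartz_deriv (SchwartzMap.derivCLM ℂ ℂ (conjSchwartz ψ)) (H.hasWeakDeriv u 0)
  have hd' : inner ℂ (schwartzL2 (SchwartzMap.derivCLM ℂ ℂ (conjSchwartz ψ))) (u.1 1) =
      -∫ x, u.1 0 x * iteratedDeriv 2 ψ x := by
    rw [← inner_conjSchwartz_deriv_deriv]
    exact (neg_eq_iff_eq_neg.2 hd).symm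
  have i₁ : Integrable fun x => -(u.1 0 x * iteratedDeriv 2 ψ x) := i₂.neg
  have i₃ : Integrable fun x => (Complex.I * P.α / 2 + P.c) * (u.1 0 x * ψ x) := i₀.const_mul _
  have i₄ : Integrable fun x => -(u.1 0 x * iteratedDeriv 2 ψ x) -
    (Complex.I * P.α / 2 + P.c) * (u.1 0 x * ψ x) := i₁.sub i₃
  rw [integral_congr_ae e, integral_add i₄ iN, integral_sub i₁ i₃, integral_neg,
    integral_const_mul, weakForm,
    schwartzH1_zero, schwartzH1_one, hd', hF, inner_sub_right, inner_smul_right, inner_smul_right,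
    inner_conjSchwartz, inner_conjSchwartz]
  linear_combination -(P.c * (∫ x, u.1 0 x * ψ x) + (∫ x, u.1 0 x * iteratedDeriv 2 ψ x) -
    ∫ x, (P.nonlin u).1 0 x * ψ x) * Complex.I_mul_I

theorem isSolution_iff {φ : ℝ → H (k + 1)} : P.IsSolution φ ↔ ∀ ψ : 𝓢(ℝ, ℂ), ∀ t : ℝ, 0 ≤ t →
    HasDerivWithinAt (fun s => inner ℂ (schwartzL2 ψ) ((φ s).1 0))
      (weakForm ((φ t).1 1) ((P.force (φ t)).1 0) (schwartzH1 ψ)) (Ici 0) t := by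
  constructor
  · intro h ψ t ht
    have h₁ := (h (conjSchwartz ψ) t ht).const_mul (-Complex.I)
    simp only [integral_equation_eq, conjSchwartz_conjSchwartz] at h₁
    simp only [H.fn, ← inner_conjSchwartz, conjSchwartz_conjSchwartz,
      ← mul_assoc, neg_mul, Complex.I_mul_I, neg_neg, one_mul] at h₁
    exact h₁
  · intro h ψ t ht
    have h₁ := (h (conjSchwartz ψ) t ht).const_mul Complex.I
    simp only [integral_equation_eq]
    simp only [H.fn, ← inner_conjSchwartz]
    exact h₁

theorem IsSolution.isWeakSolution {φ : ℝ → H (k + 1)} (hc : ContinuousOn φ (Ici 0))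
    (h : P.IsSolution φ) (T : ℝ) :
    IsWeakSolution (fun t => (P.force (φ t)).1 0) T (fun t => H.toH1 (φ t)) where
  continuousOn := H.toH1.continuous.comp_continuousOn (hc.mono Icc_subset_Ici_self)
  continuousOn_force := ((H.comp 0).continuous.comp P.continuous_force).comp_continuousOn
    (hc.mono Icc_subset_Ici_self)
  hasDerivWithinAt ψ t ht :=
    ((P.isSolution_iff.1 h) ψ t ht.1).mono (Ici_subset_Ici.2 ht.1)

/-- The vector field of the equation in the interaction picture. -/
def field (t : ℝ) (v : H (k + 1)) : H (k + 1) := freeH (-t) (P.force (freeH t v))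

theorem isWeakSolution_of_field {v : ℝ → H (k + 1)} {T : ℝ} (h : IsForwardSolution P.field T v) :
    IsWeakSolution (fun t => (P.force (freeH t (v t))).1 0) T
      (fun t => H.toH1 (freeH t (v t))) := by
  have hc : ContinuousOn (fun t => freeH t (v t)) (Icc 0 T) :=
    continuous_freeH.comp_continuousOn (f := fun t => (t, v t))
      (continuousOn_id.prodMk h.continuousOn)
  have hF : Continuous fun u : H (k + 1) => (P.force u).1 0 :=
    (H.comp (k := k + 1) 0).continuous.comp P.continuous_force
  refine ⟨(H.toH1 (k := k)).continuous.comp_continuousOn hc, hF.comp_continuousOn hc,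
    fun ψ t ht => ?_⟩
  have h₁ := h.hasDerivWithinAt t ht
  rw [field] at h₁
  exact hasDerivWithinAt_inner_freeH h₁ ψ

/-- The squared `L²` norm of the difference has derivative at most `2L` times itself, `L` depending
on the `H^{k+1}` bounds of both solutions on `[0, T]`. It vanishes at `0`, so Grönwall makes it
vanish throughout. -/
theorem eqOn_of_isGlobalSolution {φ₀ : H (k + 1)} {φ φ' : ℝ → H (k + 1)}
    (h : P.IsGlobalSolution φ₀ φ) (h' : P.IsGlobalSolution φ₀ φ') : EqOn φ' φ (Ici 0) := by
  intro T hT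
  have hT : 0 ≤ T := hT
  have w := (h'.solves.isWeakSolution P h'.continuousOn T).sub
    (h.solves.isWeakSolution P h.continuousOn T)
  obtain ⟨B, hB⟩ := isCompact_Icc.exists_bound_of_continuousOn
    (h.continuousOn.mono (fun t ht => ht.1 : Icc 0 T ⊆ Ici 0))
  obtain ⟨B', hB'⟩ := isCompact_Icc.exists_bound_of_continuousOn
    (h'.continuousOn.mono (fun t ht => ht.1 : Icc 0 T ⊆ Ici 0))
  obtain ⟨L, hL0, hL⟩ := P.exists_norm_force_sub_comp_le (k := k) (max B B')
  have hc : ContinuousOn (fun t => ‖(φ' t).1 0 - (φ t).1 0‖ ^ 2) (Icc 0 T) :=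
    (((H.comp 0).continuous.comp_continuousOn w.continuousOn).norm).pow 2
  have hb := le_exp_of_deriv_right_le (K := 2 * L) hc
    (fun t ht => w.hasDerivWithinAt_norm_sq ht) (fun t ht => ?_) T ⟨hT, le_rfl⟩
  · rw [h.initial, h'.initial, sub_self, norm_zero, zero_pow two_ne_zero, zero_mul] at hb
    have h₀ : (φ' T).1 0 - (φ T).1 0 = 0 := by
      rw [← norm_eq_zero, ← sq_eq_zero_iff]
      exact le_antisymm hb (sq_nonneg _)
    exact H.ext (sub_eq_zero.1 h₀)
  · have ht' := Ico_subset_Icc_self ht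
    have h₁ := hL (φ' t) (φ t) ((hB' t ht').trans (le_max_right _ _))
      ((hB t ht').trans (le_max_left _ _))
    have h₂ : (inner ℂ ((φ' t).1 0 - (φ t).1 0) ((P.force (φ' t)).1 0 - (P.force (φ t)).1 0)).re ≤
        ‖(φ' t).1 0 - (φ t).1 0‖ * (L * ‖(φ' t).1 0 - (φ t).1 0‖) :=
      (Complex.re_le_norm _).trans ((norm_inner_le_norm _ _).trans
        (mul_le_mul_of_nonneg_left h₁ (norm_nonneg _)))
    calc _ ≤ 2 * (‖(φ' t).1 0 - (φ t).1 0‖ * (L * ‖(φ' t).1 0 - (φ t).1 0‖)) :=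
          mul_le_mul_of_nonneg_left h₂ zero_le_two
      _ = _ := by ring

end Params

/-! ### The modified energy and a priori bounds. -/

theorem inner_freeH_right (t : ℝ) (u w : H 1) :
    inner ℂ u (freeH t w) = inner ℂ (freeH (-t) u) w := by
  simp only [H.inner_H1, freeH_apply, inner_freeL2_right]

theorem weakForm_smul (f₁ A : L2) (c : ℂ) (m : H 1) :
    weakForm f₁ A (c • m) = (starRingEnd ℂ) c * weakForm f₁ A m := by
  have e₀ : (c • m).1 0 = c • m.1 0 := rfl
  have e₁ : (c • m).1 1 = c • m.1 1 := rfl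
  simp only [weakForm, e₀, e₁, inner_smul_left]
  ring

theorem inner_im_symm (f g : L2) : (inner ℂ f g).im = -(inner ℂ g f).im := by
  rw [← inner_conj_symm, Complex.conj_im]

theorem inner_self_im_L2 (f : L2) : (inner ℂ f f).im = 0 := inner_self_im (𝕜 := ℂ) f

theorem inner_self_re_L2 (f : L2) : (inner ℂ f f).re = ‖f‖ ^ 2 :=
  (norm_sq_eq_re_inner (𝕜 := ℂ) f).symm

namespace Params

variable (P : Params)

/-- The modified energy `‖u‖²_{H^1} + (g/2) ‖|u + η|² - |η|²‖²_{L²}`. -/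
def modEnergy (u : H 1) : ℝ := ‖u‖ ^ 2 + P.g / 2 * ‖(P.density (k := 0) u).1 0‖ ^ 2

theorem continuous_modEnergy : Continuous P.modEnergy := by
  have h : Continuous fun u : H 1 => (P.density (k := 0) u).1 0 :=
    (H.comp (k := 1) 0).continuous.comp P.continuous_density
  exact (continuous_norm.pow 2).add (continuous_const.mul (h.norm.pow 2))

/-- The time derivative of the modified energy. -/
def modEnergyRate (u : H 1) : ℝ :=
  2 * (inner ℂ u (P.force (k := 0) u)).re +
    2 * (weakForm (u.1 1) ((P.force (k := 0) u).1 0) (P.nonlin (k := 0) u)).re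

/-- The potential term is weighted so that the contributions `Im⟨∂u, ∂N⟩` and `Im⟨∂N, ∂u⟩` cancel.
Also `Re(i‖N‖²) = 0`, so only `L²` pairings of `N` with `u` survive besides the damping. -/
theorem modEnergyRate_eq (u : H 1) : P.modEnergyRate u = -P.α * ‖u‖ ^ 2
    - 2 * (1 + P.c) * (inner ℂ ((P.nonlin (k := 0) u).1 0) (u.1 0)).im
    - P.α * (inner ℂ ((P.nonlin (k := 0) u).1 0) (u.1 0)).re := by
  have e : ∀ i, (P.force (k := 0) u).1 i = (-(P.α / 2) + Complex.I * P.c : ℂ) • u.1 i -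
    Complex.I • (P.nonlin (k := 0) u).1 i := fun _ => rfl
  have hn : ‖u‖ ^ 2 = ‖u.1 0‖ ^ 2 + ‖u.1 1‖ ^ 2 := by rw [H.norm_sq, Fin.sum_univ_two]
  rw [modEnergyRate, H.inner_H1, weakForm, e, e, hn]
  simp only [inner_sub_right, inner_smul_right, Complex.add_re, Complex.sub_re, Complex.mul_re,
    Complex.neg_re, Complex.add_im, Complex.neg_im, Complex.mul_im, Complex.I_re, Complex.I_im,
    Complex.ofReal_re, Complex.ofReal_im, Complex.div_ofNat_re, Complex.div_ofNat_im,
    inner_self_re_L2, inner_self_im_L2]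
  rw [inner_im_symm (u.1 0), inner_im_symm (u.1 1)]
  ring

theorem exists_modEnergyRate_le (hα : 0 < P.α) (hg : 0 ≤ P.g) :
    ∃ K : ℝ, 0 ≤ K ∧ ∀ u, P.modEnergyRate u ≤ K * P.modEnergy u := by
  -- The first summand absorbs the `α Re` term. For the `Im` term, `g‖ρ‖²` costs `2` units of
  -- `(g/2)‖ρ‖²` and `g‖u‖²` costs `g` units of `‖u‖²`, whence `2 + g`.
  refine ⟨P.α * P.g * ‖P.R‖ ^ 2 / 2 + (1 + |P.c|) * ‖P.R‖ * (2 + P.g), by positivity,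
    fun u => ?_⟩
  have h₁ := re_inner_nonlin_ge hg (k := 0) u
  have h₂ := abs_im_inner_nonlin_le hg (k := 0) u
  have h₃ : ‖u.1 0‖ ^ 2 ≤ ‖u‖ ^ 2 := pow_le_pow_left₀ (norm_nonneg _) (H.norm_comp_le u 0) 2
  rw [modEnergyRate_eq, modEnergy]
  set x := (inner ℂ ((P.nonlin (k := 0) u).1 0) (u.1 0)).re
  set y := (inner ℂ ((P.nonlin (k := 0) u).1 0) (u.1 0)).im
  set r := ‖(P.density (k := 0) u).1 0‖ ^ 2
  have hr : 0 ≤ r := by positivity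
  set a := ‖u.1 0‖ ^ 2
  set b := ‖u‖ ^ 2
  have hb : 0 ≤ b := by positivity
  have h₄ : -((1 + P.c) * y) ≤ (1 + |P.c|) * (P.g * ‖P.R‖ / 2 * (r + b)) := by
    calc -((1 + P.c) * y) ≤ |(1 + P.c) * y| := neg_le_abs _
      _ = |1 + P.c| * |y| := abs_mul _ _
      _ ≤ (1 + |P.c|) * (P.g * ‖P.R‖ / 2 * (r + b)) := by
        gcongr
        · exact (abs_add_le _ _).trans (by rw [abs_one])
        · exact h₂.trans (by gcongr)
  have h₅ : -(P.α * x) ≤ P.α * (P.g / 2 * ‖P.R‖ ^ 2 * b) := by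
    have : P.g / 2 * ‖P.R‖ ^ 2 * a ≤ P.g / 2 * ‖P.R‖ ^ 2 * b := by gcongr
    nlinarith
  have h₆ : 0 ≤ P.α * b := by positivity
  have h₇ : 0 ≤ P.α * P.g * ‖P.R‖ ^ 2 / 2 * (P.g / 2 * r) := by positivity
  have h₈ : 0 ≤ (1 + |P.c|) * ‖P.R‖ * (2 * b + P.g * (P.g / 2 * r)) := by positivity
  linarith

/-- The `H^1` norm of `φ` equals that of `v`, which is differentiable in `H^1`, so this half needs
no extra regularity of `φ`. The `ρ` half uses the chain rule for weak solutions. -/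
theorem hasDerivWithinAt_modEnergy {v : ℝ → H 1} {T t : ℝ}
    (h : IsForwardSolution (P.field (k := 0)) T v) (ht : t ∈ Ico 0 T) :
    HasDerivWithinAt (fun s => P.modEnergy (freeH s (v s))) (P.modEnergyRate (freeH t (v t)))
      (Ici t) t := by
  have h₁ : HasDerivWithinAt (fun s => ‖freeH s (v s)‖ ^ 2)
      (2 * (inner ℂ (freeH t (v t)) (P.force (k := 0) (freeH t (v t)))).re) (Ici t) t := by
    have hv := h.hasDerivWithinAt t ht
    rw [field] at hv
    have h₂ := Complex.reCLM.hasFDerivAt.comp_hasDerivWithinAt t (hv.inner ℂ hv)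
    have e : ∀ s, ‖freeH s (v s)‖ ^ 2 = (inner ℂ (v s) (v s)).re := fun s => by
      rw [norm_freeH]
      exact norm_sq_eq_re_inner (𝕜 := ℂ) (v s)
    simp only [e]
    refine HasDerivWithinAt.congr_deriv h₂ ?_
    rw [Complex.reCLM_apply, Complex.add_re, ← inner_conj_symm (freeH (-t) _), Complex.conj_re,
      inner_freeH_right, neg_neg]
    ring
  have hw := P.isWeakSolution_of_field h
  have e : ∀ u : H 1, H.toH1 (k := 0) u = u := fun u => H.ext rfl
  simp only [e] at hw
  set φ := fun s => freeH s (v s) with hφ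
  have hM : Continuous fun u : H 1 => H.mul (P.density (k := 0) u + P.density (k := 0) (φ t))
      (u + φ t) + (2 * P.R) • H.plane P.κ (P.density (k := 0) u + P.density (k := 0) (φ t)) := by
    have h₃ : Continuous fun u : H 1 => P.density (k := 0) u + P.density (k := 0) (φ t) :=
      P.continuous_density.add continuous_const
    have h₄ : Continuous fun u : H 1 => H.mul (P.density (k := 0) u + P.density (k := 0) (φ t))
        (u + φ t) :=
      ((H.mul (k := 0)).continuous.comp h₃).clm_apply (continuous_id.add continuous_const)
    exact h₄.add (((H.plane P.κ).continuous.comp h₃).const_smul (2 * P.R))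
  have h₂ := hw.hasDerivWithinAt_of_sub_eq ht ((hM.tendsto _).comp (hw.tendsto_nhdsGT ht))
    (J := fun s => ‖(P.density (k := 0) (φ s)).1 0‖ ^ 2)
    (fun s => P.norm_sq_density_sub (k := 0) (φ s) (φ t))
  refine (h₁.add (h₂.const_mul (P.g / 2))).congr_deriv ?_
  rw [modEnergyRate]
  congr 1
  -- At `s = t` the gradient is `(2ρ)(2φ) + 2η(2ρ) = 4ρ(φ + η)`, so the nonlinearity is `g/4` times
  -- it.
  have e₂ : P.nonlin (k := 0) (φ t) = ((P.g / 4 : ℝ) : ℂ) •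
      (H.mul (P.density (k := 0) (φ t) + P.density (k := 0) (φ t)) (φ t + φ t) +
        (2 * P.R) • H.plane P.κ (P.density (k := 0) (φ t) + P.density (k := 0) (φ t))) := by
    rw [nonlin, ← two_smul ℂ (φ t), ← two_smul ℂ (P.density (k := 0) (φ t))]
    simp only [map_smul, smul_apply, smul_add, smul_smul]
    congr 2 <;> push_cast <;> ring
  rw [show freeH t (v t) = φ t from rfl, e₂, weakForm_smul, Complex.conj_ofReal,
    Complex.re_ofReal_mul]
  ring

theorem exists_bound_H1 (hα : 0 < P.α) (hg : 0 ≤ P.g) (v₀ : H 1) (T : ℝ) :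
    ∃ B : ℝ, ∀ t ≤ T, ∀ v, IsForwardSolution (P.field (k := 0)) t v → v 0 = v₀ →
      ∀ s ∈ Icc 0 t, ‖v s‖ ≤ B := by
  obtain ⟨K, hK, hKb⟩ := P.exists_modEnergyRate_le hα hg
  refine ⟨Real.sqrt (P.modEnergy v₀ * Real.exp (K * T)), fun t ht v hv hv0 s hs => ?_⟩
  have hc : ContinuousOn (fun t => freeH t (v t)) (Icc 0 t) :=
    continuous_freeH.comp_continuousOn (f := fun t => (t, v t))
      (continuousOn_id.prodMk hv.continuousOn)
  have h₁ := le_exp_of_deriv_right_le (P.continuous_modEnergy.comp_continuousOn hc)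
    (fun t ht => P.hasDerivWithinAt_modEnergy hv ht) (fun t _ => hKb _) s hs
  simp only [Function.comp_apply, freeH_zero, hv0] at h₁
  have h₂ : ∀ u, ‖u‖ ^ 2 ≤ P.modEnergy u := fun u => le_add_of_nonneg_right (by positivity)
  have h₃ : 0 ≤ P.modEnergy v₀ := (sq_nonneg _).trans (h₂ v₀)
  refine Real.le_sqrt_of_sq_le ?_
  rw [← norm_freeH s]
  refine ((h₂ _).trans h₁).trans ?_
  have := hs.2.trans ht
  gcongr

theorem incl_field (t : ℝ) (v : H (k + 2)) : H.incl (P.field t v) = P.field t (H.incl v) := by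
  rw [field, field, incl_freeH, incl_force, incl_freeH]

/-- Including a solution into the space one order below gives a solution of the same equation there,
bounded by induction. The tame estimate then makes the field linearly bounded in the top norm, and
Grönwall applies. -/
theorem exists_bound (hα : 0 < P.α) (hg : 0 ≤ P.g) (v₀ : H (k + 1)) (T : ℝ) :
    ∃ B : ℝ, ∀ t ≤ T, ∀ v, IsForwardSolution P.field t v → v 0 = v₀ →
      ∀ s ∈ Icc 0 t, ‖v s‖ ≤ B := by
  induction k with
  | zero => exact P.exists_bound_H1 hα hg v₀ T
  | succ k ih =>
    obtain ⟨B, hB⟩ := ih (H.incl v₀)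
    obtain ⟨K, hK, hKb⟩ := P.exists_norm_force_le_tame (k := k) B
    refine ⟨‖v₀‖ * Real.exp (K * T), fun t ht v hv hv0 s hs => ?_⟩
    have hi : IsForwardSolution P.field t (fun s => H.incl (v s)) := by
      refine ⟨(H.incl (k := k + 1)).continuous.comp_continuousOn hv.continuousOn, fun s hs => ?_⟩
      rw [← incl_field]
      exact ((H.incl (k := k + 1)).restrictScalars ℝ).hasFDerivAt.comp_hasDerivWithinAt s
        (hv.hasDerivWithinAt s hs)
    have hb : ∀ s ∈ Ico 0 t, ‖P.field s (v s)‖ ≤ K * ‖v s‖ + 0 := fun s hs => by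
      rw [field, norm_freeH, add_zero, ← norm_freeH s (v s)]
      refine hKb _ ?_
      rw [incl_freeH, norm_freeH]
      exact hB t ht _ hi (by rw [hv0]) s (Ico_subset_Icc_self hs)
    have h₁ := norm_le_gronwallBound_of_norm_deriv_right_le hv.continuousOn hv.hasDerivWithinAt
      (δ := ‖v₀‖) (by rw [hv0]) hb s hs
    rw [gronwallBound_ε0, sub_zero] at h₁
    refine h₁.trans ?_
    have := hs.2.trans ht
    gcongr

/-! ### Global existence and conclusion. -/

/-- Global existence for arbitrary data: for `λ < 0 < ω` the equation is defocusing, the modified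
energy is coercive, and no smallness is needed. -/
theorem exists_isGlobalSolution (hα : 0 < P.α) (hg : 0 ≤ P.g) (φ₀ : H (k + 1)) :
    ∃ φ, P.IsGlobalSolution φ₀ φ := by
  have hc : ∀ x : H (k + 1), Continuous fun t => P.field t x := fun x =>
    continuous_freeH.comp (f := fun t : ℝ => (-t, P.force (freeH t x)))
      (continuous_neg.prodMk (P.continuous_force.comp (continuous_freeH_left x)))
  have hL : ∀ B : ℝ, ∃ L : ℝ, 0 ≤ L ∧ ∀ (t : ℝ) (x y : H (k + 1)), ‖x‖ ≤ B → ‖y‖ ≤ B →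
      ‖P.field t x - P.field t y‖ ≤ L * ‖x - y‖ := fun B => by
    obtain ⟨L, hL, h⟩ := P.exists_norm_force_sub_le (k := k) B
    refine ⟨L, hL, fun t x y hx hy => ?_⟩
    rw [field, field, ← map_sub, norm_freeH, ← norm_freeH t (x - y), map_sub]
    exact h _ _ ((norm_freeH t x).trans_le hx) ((norm_freeH t y).trans_le hy)
  obtain ⟨v, hv0, hv⟩ := exists_global_solution hc hL
    (fun t => by rw [field, map_zero, force_zero, map_zero]) φ₀
    (fun T _ => P.exists_bound hα hg φ₀ T)
  refine ⟨fun t => freeH t (v t), ?_, ?_, ?_⟩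
  · exact continuous_freeH.comp_continuousOn (f := fun t => (t, v t))
      (continuousOn_id.prodMk fun t ht => (hv t ht).continuousWithinAt)
  · rw [hv0, freeH_zero]
  · refine P.isSolution_iff.2 fun ψ t ht => ?_
    have h₁ := hv t ht
    rw [field] at h₁
    exact hasDerivWithinAt_inner_freeH h₁ ψ

end Params

end LugiatoLefever

end

theorem theorem2 (P : LugiatoLefever.Params) (hα : 0 < P.α) (hlam : P.lam < 0) (hω : 0 < P.ω)
    (k : ℕ) (hk : 1 ≤ k) :
    ∃ δ₀ : ℝ, 0 < δ₀ ∧ ∀ φ₀ : LugiatoLefever.H k, P.E hk φ₀ < δ₀ →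
      ∃ φ : ℝ → LugiatoLefever.H k, P.IsGlobalSolution φ₀ φ ∧
        ∀ φ' : ℝ → LugiatoLefever.H k, P.IsGlobalSolution φ₀ φ' →
          Set.EqOn φ' φ (Set.Ici 0) := by
  obtain ⟨n, rfl⟩ := Nat.exists_eq_add_of_le' hk
  -- The a priori bounds hold at every energy level, so any positive number serves as `δ₀`.
  refine ⟨1, one_pos, fun φ₀ _ => ?_⟩
  obtain ⟨φ, hφ⟩ := P.exists_isGlobalSolution hα (P.g_nonneg hlam hω) φ₀
  exact ⟨φ, hφ, fun φ' hφ' => P.eqOn_of_isGlobalSolution hφ hφ'⟩
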